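/- Let $d\ge2$ and let $\Gamma=(V,\mathcal E)$ be a connected, locally finite $\mathbb Z^d$-periodic graph (loops and multiple edges allowed): $\mathbb Z^d$ acts on $\Gamma$, freely on $V$, and the fundamental graph $\Gamma_*=\Gamma/\mathbb Z^d=(V_*,\mathcal E_*)$ is finite. Let $\mathcal A_*$ be the set of oriented edges of $\Gamma_*$ (two for each unoriented edge), $\nu=\#V_*$, $\varkappa_v$ the degree of $v\in V_*$ (loops counted twice), $\varkappa=\sum_{v\in V_*}\varkappa_v$. Fix a fundamental vertex set $V_0$, i.e. a set of representatives of $V$ modulo $\mathbb Z^d$, so that each $v\in V$ is uniquely $v=v_0+[v]$ with $v_0\in V_0$, $[v]\in\mathbb Z^d$. The index of an oriented edge $\mathbf e=(u,v)$ is $\tau(\mathbf e)=[v]-[u]$; it depends only on the class of $\mathbf e$ in $\mathcal A_*$. Orient each edge in $\mathcal E_*$ in an arbitrary way; the set $\mathcal B_*$ of bridges consists of the edges in $\mathcal E_*$ with nonzero index. For $\vartheta\in\mathbb R^d$ let $\Delta(\vartheta)$ be the $\nu\times\nu$ Floquet matrix of the normalized discrete Laplacian, $$\Delta_{uv}(\vartheta)=\delta_{uv}-\frac1{\sqrt{\varkappa_u\varkappa_v}}\sum_{\mathbf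 e=(u,v)\in\mathcal A_*}e^{i\langle\tau(\mathbf e),\vartheta\rangle},\qquad u,v\in V_* .$$ Let $r$ be the number (with multiplicity) of its flat bands, i.e. of eigenvalues common to all $\Delta(\vartheta)$. Label the eigenvalues of $\Delta(\vartheta)$ as $\lambda_1(\vartheta)\le\dots\le\lambda_{\nu-r}(\vartheta)$ (those that remain after removing the flat ones) and $\lambda_n$, $\nu-r<n\le\nu$ (the flat ones). Let $\Delta_M(\vartheta)$ be the Floquet operator of the Laplacian on the equilateral metric graph (edges of length $1$): it acts in $L^2(\Gamma_*)=\bigoplus_{\mathbf e\in\mathcal E_*}L^2(0,1)$ by $(y_{\mathbf e})\mapsto(-y_{\mathbf e}'')$ on those $y$ with all $y_{\mathbf e}\in H^2(0,1)$ for which there is $Y:V_*\to\mathbb C$ with $y_{\mathbf e}(0)=Y(u)$, $y_{\mathbf e}(1)=e^{i\langle\tau(\mathbf e),\vartheta\rangle}Y(v)$ for each $\mathbf e=(u,v)\in\mathcal E_*$, and $$\sum_{\mathbf e=(v,\cdot)\in\mathcal E_*}y_{\mathbf e}'(0)-\sum_{\mathbf e=(\cdot,v)\in\mathcal E_*}e^{-i\langle\tau(\mathbf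 e),\vartheta\rangle}y_{\mathbf e}'(1)=0,\qquad v\in V_* .$$ For $1\le n\le\nu$ and $j=0,1,2,\dots$ its band functions are $E_{n,j}=z_{n,j}^2$, where $z_n=\arccos(1-\lambda_n)\in[0,\pi]$, $z_{n,j}=z_n+\pi j$ for even $j$ and $z_{n,j}=(\pi-z_n)+\pi j$ for odd $j$. For every $\vartheta$ and every real $E\notin\{(\pi k)^2:k\in\mathbb Z\setminus\{0\}\}$, the dimension of the eigenspace of $\Delta_M(\vartheta)$ at $E$ is finite and equals the number of pairs $(n,j)$ with $E_{n,j}(\vartheta)=E$. For a real function $F$ on $\mathbb R^d$ the effective form at $\vartheta_0$ is $\mu(\omega)=\frac12\frac{d^2}{d\varepsilon^2}F(\vartheta_0+\varepsilon\omega)\big|_{\varepsilon=0}$, $\omega\in\mathbb S^{d-1}$. We say that it exists if $\varepsilon\mapsto F(\vartheta_0+\varepsilon\omega)$ is $C^2$ near $0$ for each $\omega$ and $F(\vartheta)=F(\vartheta_0)+\varepsilon^2\mu(\omega)+O(\varepsilon^3)$ as $\vartheta=\vartheta_0+\varepsilon\omega$, $\varepsilon=|\vartheta-\vartheta_0|\to0$.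 Denote by $\mu_n$ and $\mu_{n,j}$ the effective forms of $\lambda_n$ and $E_{n,j}$. (i) Let $1\le n\le\nu-r$, $j\ge0$, and let $E_{n,j}$ have a (local) minimum or maximum at $\vartheta_0$, where $E_{n,j}(\vartheta_0)\ne(\pi k)^2$ for all $k\in\mathbb Z$ and $E_{n,j}(\vartheta_0)$ is a simple eigenvalue of $\Delta_M(\vartheta_0)$. Then the effective forms $\mu_n$ and $\mu_{n,j}$ at $\vartheta_0$ exist, and $$\mu_{n,j}(\omega)=\frac{2\sqrt{E_{n,j}(\vartheta_0)}}{\sin\sqrt{E_{n,j}(\vartheta_0)}}\,\mu_n(\omega)\qquad\text{for all }\omega\in\mathbb S^{d-1}.$$ (ii) At the beginning of the spectrum, i.e. at $\vartheta_0=0$ for $\lambda_1$ and $E_{1,0}$, the effective forms $\mu=\mu_1$ and $\mu_{1,0}$ exist, $\mu_{1,0}$ is the restriction to $\mathbb S^{d-1}$ of a positive definite quadratic form (it is non-degenerate), and for all $\omega\in\mathbb S^{d-1}$ $$\mu_{1,0}(\omega)=2\mu(\omega)\le\frac2{\varkappa}\sum_{\mathbf e\in\mathcal B_*}\langle\tau(\mathbf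 e),\omega\rangle^2\le\frac{2\Lambda_1}{\varkappa},$$ where $\Lambda_1$ is the largest eigenvalue of $\mathcal T_1^*\mathcal T_1$ and $\mathcal T_1$ is the matrix whose rows are the indices of all bridges in $\mathcal B_*$. There are $d$ bridges in $\mathcal B_*$ with linearly independent indices. If moreover $V_0$ is the vertex set of a subtree of $\Gamma$, then for any such $d$ bridges $$0<\frac{2\Lambda_0}{\varkappa\,\nu\,d}\le\mu_{1,0}(\omega)\qquad\text{for all }\omega\in\mathbb S^{d-1},$$ where $\Lambda_0$ is the smallest eigenvalue of $\mathcal T_0^*\mathcal T_0$ and $\mathcal T_0$ is the $d\times d$ matrix whose rows are the indices of these $d$ bridges. -/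

import Mathlib

open scoped BigOperators

noncomputable section

/-- A connected locally finite `ℤ^d`-periodic graph with vertex set `V` and set of oriented edges
`A`; loops and multiple edges are allowed.  Each unoriented edge corresponds to the two oriented
edges `a` and `inv a` (so a loop also gives two oriented edges). -/
structure PeriodicGraph (d : ℕ) (V A : Type*)
    [AddAction (Fin d → ℤ) V] [AddAction (Fin d → ℤ) A] where
  /-- initial vertex of an oriented edge -/
  src : A → V
  /-- terminal vertex of an oriented edge -/
  tgt : A → V
  /-- the same edge with the opposite orientation -/
  inv : A → A
  inv_inv : ∀ a, inv (inv a) = a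
  inv_ne : ∀ a, inv a ≠ a
  src_inv : ∀ a, src (inv a) = tgt a
  src_vadd : ∀ (m : Fin d → ℤ) (a : A), src (m +ᵥ a) = m +ᵥ src a
  tgt_vadd : ∀ (m : Fin d → ℤ) (a : A), tgt (m +ᵥ a) = m +ᵥ tgt a
  inv_vadd : ∀ (m : Fin d → ℤ) (a : A), inv (m +ᵥ a) = m +ᵥ inv a
  /-- the action on vertices is free -/
  free : ∀ (m : Fin d → ℤ) (v : V), m +ᵥ v = v → m = 0
  nonempty : Nonempty V
  connected : ∀ u v : V, Relation.ReflTransGen (fun x y => ∃ a, src a = x ∧ tgt a = y) u v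
  locallyFinite : ∀ v : V, {a : A | src a = v}.Finite
  finite_vertices : Finite (AddAction.orbitRel.Quotient (Fin d → ℤ) V)
  finite_edges : Finite (AddAction.orbitRel.Quotient (Fin d → ℤ) A)

namespace PeriodicGraph

variable {d : ℕ} {V A : Type*} [AddAction (Fin d → ℤ) V] [AddAction (Fin d → ℤ) A]

/-- The underlying simple graph (loops dropped, parallel edges identified). -/
def toSimpleGraph (G : PeriodicGraph d V A) : SimpleGraph V where
  Adj u v := u ≠ v ∧ ∃ a, G.src a = u ∧ G.tgt a = v
  symm := ⟨by
    rintro u v ⟨h, a, rfl, rfl⟩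
    exact ⟨h.symm, G.inv a, G.src_inv a, by rw [← G.src_inv, G.inv_inv]⟩⟩
  loopless := ⟨fun _ h => h.1 rfl⟩

/-! ### The fundamental graph -/

/-- Vertices `V_* = V / ℤ^d` of the fundamental graph. -/
def FundVertex (_G : PeriodicGraph d V A) : Type _ :=
  AddAction.orbitRel.Quotient (Fin d → ℤ) V

/-- Oriented edges `A_* = A / ℤ^d` of the fundamental graph. -/
def FundEdge (_G : PeriodicGraph d V A) : Type _ :=
  AddAction.orbitRel.Quotient (Fin d → ℤ) A

instance (G : PeriodicGraph d V A) : Fintype G.FundVertex :=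
  @Fintype.ofFinite _ G.finite_vertices

instance (G : PeriodicGraph d V A) : Fintype G.FundEdge :=
  @Fintype.ofFinite _ G.finite_edges

instance (G : PeriodicGraph d V A) : DecidableEq G.FundVertex := Classical.decEq _

instance (G : PeriodicGraph d V A) : DecidableEq G.FundEdge := Classical.decEq _

/-- Initial vertex on the fundamental graph. -/
def fsrc (G : PeriodicGraph d V A) : G.FundEdge → G.FundVertex :=
  Quotient.map' G.src (by
    rintro a b ⟨m, rfl⟩
    exact ⟨m, (G.src_vadd m b).symm⟩)

/-- Terminal vertex on the fundamental graph. -/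
def ftgt (G : PeriodicGraph d V A) : G.FundEdge → G.FundVertex :=
  Quotient.map' G.tgt (by
    rintro a b ⟨m, rfl⟩
    exact ⟨m, (G.tgt_vadd m b).symm⟩)

/-- Reversal of oriented edges on the fundamental graph. -/
def finv (G : PeriodicGraph d V A) : G.FundEdge → G.FundEdge :=
  Quotient.map' G.inv (by
    rintro a b ⟨m, rfl⟩
    exact ⟨m, (G.inv_vadd m b).symm⟩)

/-- The degree `ϰ_v` of a vertex of the fundamental graph (loops counted twice). -/
def deg (G : PeriodicGraph d V A) (v : G.FundVertex) : ℕ :=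
  (Finset.univ.filter fun a : G.FundEdge => G.fsrc a = v).card

/-- The sum `ϰ` of the degrees of all vertices of the fundamental graph. -/
def totalDeg (G : PeriodicGraph d V A) : ℕ := ∑ v : G.FundVertex, G.deg v

/-- The number `ν` of vertices of the fundamental graph. -/
def nu (G : PeriodicGraph d V A) : ℕ := Fintype.card G.FundVertex

/-- An orientation of the unoriented edges of the fundamental graph: exactly one of `a`, `inv a`
is chosen.  The set of chosen oriented edges stands for the set of unoriented edges. -/
structure Orientation (G : PeriodicGraph d V A) where
  carrier : Set G.FundEdge
  mem_iff : ∀ a, a ∈ carrier ↔ G.finv a ∉ carrier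

/-- A fundamental vertex set: a set of representatives of the vertices modulo `ℤ^d`. -/
structure FundamentalVertexSet (G : PeriodicGraph d V A) where
  carrier : Set V
  existsUnique : ∀ v : V, ∃! v₀ : V, v₀ ∈ carrier ∧ ∃ m : Fin d → ℤ, m +ᵥ v₀ = v

/-- `V₀` is the vertex set of a subtree of the periodic graph. -/
def FundamentalVertexSet.IsTree {G : PeriodicGraph d V A} (V₀ : G.FundamentalVertexSet) : Prop :=
  ∃ T : G.toSimpleGraph.Subgraph, T.verts = V₀.carrier ∧ T.coe.IsTree

/-- The coordinates `[v]` of a vertex: `v = v₀ + [v]` with `v₀ ∈ V₀`. -/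
def coord {G : PeriodicGraph d V A} (V₀ : G.FundamentalVertexSet) (v : V) : Fin d → ℤ :=
  (V₀.existsUnique v).exists.choose_spec.2.choose

theorem coord_spec {G : PeriodicGraph d V A} (V₀ : G.FundamentalVertexSet) (v : V) :
    ∃ v₀ ∈ V₀.carrier, coord V₀ v +ᵥ v₀ = v :=
  ⟨_, (V₀.existsUnique v).exists.choose_spec.1,
    (V₀.existsUnique v).exists.choose_spec.2.choose_spec⟩

theorem coord_eq {G : PeriodicGraph d V A} (V₀ : G.FundamentalVertexSet) {v v₀ : V}
    {m : Fin d → ℤ} (h₀ : v₀ ∈ V₀.carrier) (h : m +ᵥ v₀ = v) : coord V₀ v = m := by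
  obtain ⟨u₀, hu, hc⟩ := coord_spec V₀ v
  have e : u₀ = v₀ := (V₀.existsUnique v).unique ⟨hu, _, hc⟩ ⟨h₀, _, h⟩
  subst e
  have : (-m + coord V₀ v) +ᵥ u₀ = u₀ := by
    rw [add_vadd, hc, ← h, neg_vadd_vadd]
  have := G.free _ _ this
  exact (neg_add_eq_zero.mp this).symm

theorem coord_vadd {G : PeriodicGraph d V A} (V₀ : G.FundamentalVertexSet) (m : Fin d → ℤ)
    (v : V) : coord V₀ (m +ᵥ v) = m + coord V₀ v := by
  obtain ⟨v₀, h₀, h⟩ := coord_spec V₀ v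
  exact coord_eq V₀ h₀ (by rw [add_vadd, h])

/-- The index `τ(e) = [v] - [u]` of an oriented edge `e = (u, v)` of the fundamental graph. -/
def index {G : PeriodicGraph d V A} (V₀ : G.FundamentalVertexSet) : G.FundEdge → (Fin d → ℤ) :=
  fun e => Quotient.liftOn' e (fun a => coord V₀ (G.tgt a) - coord V₀ (G.src a)) (by
    rintro a b ⟨m, rfl⟩
    simp only [G.src_vadd, G.tgt_vadd, coord_vadd]
    abel)

/-- `⟨τ(e), x⟩` for `x ∈ ℝ^d`. -/
def pairing {G : PeriodicGraph d V A} (V₀ : G.FundamentalVertexSet) (e : G.FundEdge)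
    (x : EuclideanSpace ℝ (Fin d)) : ℝ :=
  ∑ i, (index V₀ e i : ℝ) * x i

/-- The bridges: edges with nonzero index, in the chosen orientation. -/
def bridges {G : PeriodicGraph d V A} (V₀ : G.FundamentalVertexSet) (O : G.Orientation) :
    Finset G.FundEdge :=
  open Classical in Finset.univ.filter fun e => e ∈ O.carrier ∧ index V₀ e ≠ 0

/-- The matrix whose rows are the indices of a given family of edges. -/
def indexMatrix {G : PeriodicGraph d V A} (V₀ : G.FundamentalVertexSet) {ι : Type*}
    (b : ι → G.FundEdge) : Matrix ι (Fin d) ℝ :=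
  Matrix.of fun i k => (index V₀ (b i) k : ℝ)

/-! ### The discrete Laplacian -/

/-- The Floquet matrix `Δ(θ)` of the normalized discrete Laplacian. -/
def floquet {G : PeriodicGraph d V A} (V₀ : G.FundamentalVertexSet)
    (θ : EuclideanSpace ℝ (Fin d)) : Matrix G.FundVertex G.FundVertex ℂ :=
  Matrix.of fun u v => (if u = v then 1 else 0) -
    ((1 / Real.sqrt (G.deg u * G.deg v) : ℝ) : ℂ) *
      ∑ e : G.FundEdge with G.fsrc e = u ∧ G.ftgt e = v,
        Complex.exp (Complex.I * (pairing V₀ e θ : ℝ))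

/-- The eigenvalues of the Hermitian matrix `Δ(θ)`, counted with multiplicity. -/
def eigs {G : PeriodicGraph d V A} (V₀ : G.FundamentalVertexSet)
    (θ : EuclideanSpace ℝ (Fin d)) : Multiset ℝ :=
  (floquet V₀ θ).charpoly.roots.map Complex.re

/-- The flat bands: `x` occurs as often as it is an eigenvalue of every `Δ(θ)`, with
multiplicity. -/
def flatBands {G : PeriodicGraph d V A} (V₀ : G.FundamentalVertexSet) : Multiset ℝ :=
  ∑ x ∈ (eigs V₀ 0).toFinset, Multiset.replicate (⨅ θ, (eigs V₀ θ).count x) x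

/-- The number `r` of flat bands. -/
def numFlat {G : PeriodicGraph d V A} (V₀ : G.FundamentalVertexSet) : ℕ :=
  Multiset.card (flatBands V₀)

/-- The band functions `λ_n(θ)`, `1 ≤ n ≤ ν`: the non-flat ones in non-decreasing order for
`n ≤ ν - r`, followed by the `r` flat ones. -/
def band {G : PeriodicGraph d V A} (V₀ : G.FundamentalVertexSet) (n : ℕ)
    (θ : EuclideanSpace ℝ (Fin d)) : ℝ :=
  ((eigs V₀ θ - flatBands V₀).sort (· ≤ ·) ++ (flatBands V₀).sort (· ≤ ·)).getD (n - 1) 0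

/-! ### The metric Laplacian -/

/-- The space `L²(Γ_*)`: an `L²(0,1)` function on each (oriented) edge of the fundamental graph. -/
abbrev MetricL2 (G : PeriodicGraph d V A) (O : G.Orientation) : Type _ :=
  O.carrier → MeasureTheory.Lp ℂ 2 (MeasureTheory.volume.restrict (Set.Icc (0 : ℝ) 1))

/-- `(y, w)` belongs to the graph of the Floquet operator `Δ_M(θ)`, that is, `y` lies in its
domain and `Δ_M(θ) y = w`.  Here `f` is the continuously differentiable representative of `y`,
`p = f'`, and `p' = -w` with `w ∈ L²`.  The functions are read on the lifts of the edges that start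
in the fundamental vertex set, and extended to the periodic graph by `f(x + m) = e^{i⟨m,θ⟩} f(x)`;
continuity and the Kirchhoff conditions on the periodic graph then read as follows. -/
def IsMetricFloquet {G : PeriodicGraph d V A} (V₀ : G.FundamentalVertexSet) (O : G.Orientation)
    (θ : EuclideanSpace ℝ (Fin d)) (y w : G.MetricL2 O) : Prop :=
  ∃ f p : O.carrier → ℝ → ℂ,
    (∀ e, y e =ᵐ[MeasureTheory.volume.restrict (Set.Icc (0 : ℝ) 1)] f e) ∧
    (∀ e, ∀ t ∈ Set.Icc (0 : ℝ) 1, HasDerivWithinAt (f e) (p e t) (Set.Icc 0 1) t) ∧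
    (∀ e, ∀ t ∈ Set.Icc (0 : ℝ) 1, p e t = p e 0 - ∫ s in (0 : ℝ)..t, w e s) ∧
    (∃ Y : G.FundVertex → ℂ, ∀ e : O.carrier, f e 0 = Y (G.fsrc e) ∧
      f e 1 = Complex.exp (Complex.I * (pairing V₀ e θ : ℝ)) * Y (G.ftgt e)) ∧
    (open Classical in ∀ v : G.FundVertex,
      (∑ e : O.carrier, if G.fsrc e = v then p e 0 else 0) -
        (∑ e : O.carrier, if G.ftgt e = v then
          Complex.exp (-(Complex.I * (pairing V₀ e θ : ℝ))) * p e 1 else 0) = 0)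

theorem intervalIntegrable_L2 (w : MeasureTheory.Lp ℂ 2
    (MeasureTheory.volume.restrict (Set.Icc (0 : ℝ) 1))) {t : ℝ} (ht : t ∈ Set.Icc (0 : ℝ) 1) :
    IntervalIntegrable (w : ℝ → ℂ) MeasureTheory.volume 0 t := by
  have h := (MeasureTheory.Lp.memLp w).integrable (by norm_num)
  rw [intervalIntegrable_iff_integrableOn_Ioc_of_le ht.1]
  exact MeasureTheory.IntegrableOn.mono_set h
    (fun s hs => ⟨hs.1.le, hs.2.trans ht.2⟩)

theorem integral_L2_congr {w w' : ℝ → ℂ}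
    (h : w =ᵐ[MeasureTheory.volume.restrict (Set.Icc (0 : ℝ) 1)] w') {t : ℝ}
    (ht : t ∈ Set.Icc (0 : ℝ) 1) : ∫ s in (0 : ℝ)..t, w s = ∫ s in (0 : ℝ)..t, w' s := by
  rw [intervalIntegral.integral_of_le ht.1, intervalIntegral.integral_of_le ht.1]
  refine MeasureTheory.integral_congr_ae (MeasureTheory.ae_restrict_of_ae_restrict_of_subset ?_ h)
  exact fun s hs => ⟨hs.1.le, hs.2.trans ht.2⟩

/-- The graph of the Floquet operator `Δ_M(θ)` as a linear subspace. -/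
def metricFloquetGraph {G : PeriodicGraph d V A} (V₀ : G.FundamentalVertexSet)
    (O : G.Orientation) (θ : EuclideanSpace ℝ (Fin d)) :
    Submodule ℂ (G.MetricL2 O × G.MetricL2 O) where
  carrier := {q | IsMetricFloquet V₀ O θ q.1 q.2}
  zero_mem' := by
    refine ⟨0, 0, fun e => MeasureTheory.Lp.coeFn_zero _ _ _, fun e t _ => ?_, fun e t ht => ?_,
      ⟨0, fun e => by simp⟩, fun v => by simp⟩
    · exact hasDerivWithinAt_const t _ (0 : ℂ)
    · have := integral_L2_congr (MeasureTheory.Lp.coeFn_zero ℂ 2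
        (MeasureTheory.volume.restrict (Set.Icc (0 : ℝ) 1))) ht
      simp only [Prod.snd_zero, Pi.zero_apply]
      rw [this]
      simp
  add_mem' := by
    rintro ⟨y, w⟩ ⟨y', w'⟩ ⟨f, p, h1, h2, h3, ⟨Y, h4⟩, h5⟩ ⟨f', p', h1', h2', h3', ⟨Y', h4'⟩, h5'⟩
    refine ⟨f + f', p + p', fun e => ?_, fun e t ht => (h2 e t ht).add (h2' e t ht),
      fun e t ht => ?_, ⟨Y + Y', fun e => ⟨?_, ?_⟩⟩, fun v => ?_⟩
    · exact (MeasureTheory.Lp.coeFn_add (y e) (y' e)).trans ((h1 e).add (h1' e))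
    · have := integral_L2_congr (MeasureTheory.Lp.coeFn_add (w e) (w' e)) ht
      simp only [Prod.mk_add_mk, Pi.add_apply] at this ⊢
      rw [this, intervalIntegral.integral_add (intervalIntegrable_L2 _ ht)
        (intervalIntegrable_L2 _ ht), h3 e t ht, h3' e t ht]
      ring
    · simp only [Pi.add_apply, (h4 e).1, (h4' e).1]
    · simp only [Pi.add_apply, (h4 e).2, (h4' e).2]
      ring
    · refine Eq.trans ?_ ((congrArg₂ (· + ·) (h5 v) (h5' v)).trans (add_zero 0))
      simp only [← Finset.sum_sub_distrib, ← Finset.sum_add_distrib]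
      refine Finset.sum_congr rfl fun e _ => ?_
      split_ifs <;> (try simp only [Pi.add_apply]) <;> ring
  smul_mem' := by
    rintro c ⟨y, w⟩ ⟨f, p, h1, h2, h3, ⟨Y, h4⟩, h5⟩
    refine ⟨c • f, c • p, fun e => ?_, fun e t ht => (h2 e t ht).const_smul c,
      fun e t ht => ?_, ⟨c • Y, fun e => ⟨?_, ?_⟩⟩, fun v => ?_⟩
    · exact (MeasureTheory.Lp.coeFn_smul c (y e)).trans ((h1 e).const_smul c)
    · have := integral_L2_congr (MeasureTheory.Lp.coeFn_smul c (w e)) ht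
      simp only [Prod.smul_mk, Pi.smul_apply] at this ⊢
      rw [this, intervalIntegral.integral_smul, h3 e t ht, smul_sub]
    · simp only [Pi.smul_apply, (h4 e).1]
    · simp only [Pi.smul_apply, (h4 e).2, smul_eq_mul]
      ring
    · refine Eq.trans ?_ ((congrArg (c * ·) (h5 v)).trans (mul_zero c))
      simp only [← Finset.sum_sub_distrib, Finset.mul_sum]
      refine Finset.sum_congr rfl fun e _ => ?_
      split_ifs <;> (try simp only [Pi.smul_apply, smul_eq_mul]) <;> ring

/-- The eigenspace `{y : Δ_M(θ) y = E y}` of the Floquet operator `Δ_M(θ)`. -/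
def metricEigenspace {G : PeriodicGraph d V A} (V₀ : G.FundamentalVertexSet)
    (O : G.Orientation) (θ : EuclideanSpace ℝ (Fin d)) (E : ℝ) :
    Submodule ℂ (G.MetricL2 O) :=
  (metricFloquetGraph V₀ O θ).comap
    (LinearMap.prod LinearMap.id ((E : ℂ) • LinearMap.id))

/-- `E` is a simple eigenvalue of `Δ_M(θ)`. -/
def IsSimpleMetricEigenvalue {G : PeriodicGraph d V A} (V₀ : G.FundamentalVertexSet)
    (O : G.Orientation) (θ : EuclideanSpace ℝ (Fin d)) (E : ℝ) : Prop :=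
  Module.finrank ℂ (metricEigenspace V₀ O θ E) = 1

/-- `z_{n,j}(θ)`, where `z_n(θ) = arccos (1 - λ_n(θ))`. -/
def metricZ {G : PeriodicGraph d V A} (V₀ : G.FundamentalVertexSet) (n j : ℕ)
    (θ : EuclideanSpace ℝ (Fin d)) : ℝ :=
  if Even j then Real.arccos (1 - band V₀ n θ) + Real.pi * j
  else (Real.pi - Real.arccos (1 - band V₀ n θ)) + Real.pi * j

/-- The band functions `E_{n,j}(θ) = z_{n,j}(θ)²` of the metric Laplacian. -/
def metricBand {G : PeriodicGraph d V A} (V₀ : G.FundamentalVertexSet) (n j : ℕ)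
    (θ : EuclideanSpace ℝ (Fin d)) : ℝ :=
  metricZ V₀ n j θ ^ 2

end PeriodicGraph

/-! ### Effective forms -/

/-- The effective form `μ(ω) = ½ ∂²/∂ε² F(θ₀ + εω) |_{ε = 0}`. -/
def effectiveForm {d : ℕ} (F : EuclideanSpace ℝ (Fin d) → ℝ) (θ₀ ω : EuclideanSpace ℝ (Fin d)) :
    ℝ :=
  1 / 2 * iteratedDeriv 2 (fun ε : ℝ => F (θ₀ + ε • ω)) 0

/-- The effective form of `F` at `θ₀` is well defined: `F` is twice continuously differentiable
at `θ₀` in all directions, and `F(θ) = F(θ₀) + ε² μ(ω) + O(ε³)` as `θ = θ₀ + εω`,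
`ε = |θ - θ₀| → 0`. -/
def HasEffectiveForm {d : ℕ} (F : EuclideanSpace ℝ (Fin d) → ℝ)
    (θ₀ : EuclideanSpace ℝ (Fin d)) : Prop :=
  (∀ ω : EuclideanSpace ℝ (Fin d), ContDiffAt ℝ 2 (fun ε : ℝ => F (θ₀ + ε • ω)) 0) ∧
  (fun θ => F θ - (F θ₀ + ‖θ - θ₀‖ ^ 2 * effectiveForm F θ₀ (‖θ - θ₀‖⁻¹ • (θ - θ₀))))
    =O[nhds θ₀] (fun θ => ‖θ - θ₀‖ ^ 3)

end

/-!
On every edge the equation `-y'' = E y` with `E = z²` is solved by its two boundary values, provided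
`E` is not a Dirichlet eigenvalue. Kirchhoff's condition then becomes the eigenvalue equation of the
discrete operator at `1 - cos z`. Hence `E_{n,j} = h(λ_n)` with `h x` the square of the angle
`arccos (1 - x)` folded into `[πj, π(j + 1)]`, and multiplicities agree.

A simple eigenvalue of `Δ(θ)` is a simple root of the characteristic polynomial and depends
continuously, hence by the implicit function theorem analytically, on `θ`. At an extremum the
gradient vanishes, so the second order terms of `λ_n` and `h(λ_n)` differ by the factor
`h'(λ_n) = 2 z / sin z`. At the bottom of the spectrum `z = 0`, and the factor is the limit `2`.

The Rayleigh quotient of the energy at the constant function gives the upper bounds. For the lower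
bounds, the eigenvector of `λ_1(θ)` near `θ = 0` is almost constant. A lattice shift by `m` changes
its Bloch function by the factor `e^{i⟨m, θ⟩}`, so the sum of `⟨m, θ⟩²` over the edges or paths that
realize the shifts `m` is controlled by the energy. If `V₀` is the vertex set of a subtree, a bridge
of index `m` and a path in the tree join a vertex to its shift by `m` using at most `ν` edges.
-/

open Filter Topology Asymptotics

/-! ### Effective forms -/

section TaylorTwo

variable {E F : Type*} [NormedAddCommGroup E] [NormedSpace ℝ E]
  [NormedAddCommGroup F] [NormedSpace ℝ F]

theorem tendsto_add_smul_nhds (x v : E) :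
    Tendsto (fun ε : ℝ => x + ε • v) (𝓝 0) (𝓝 x) := by
  have hline : Continuous fun ε : ℝ => x + ε • v := by fun_prop
  simpa using hline.tendsto 0

theorem tendsto_add_smul_nhdsGT (x v : E) :
    Tendsto (fun ε : ℝ => x + ε • v) (𝓝[>] 0) (𝓝 x) :=
  (tendsto_add_smul_nhds x v).mono_left nhdsWithin_le_nhds

theorem iteratedDeriv_two_add_smul {f : E → F} {x : E} (hf : ContDiffAt ℝ 2 f x) (v : E) :
    iteratedDeriv 2 (fun ε : ℝ => f (x + ε • v)) 0 = fderiv ℝ (fderiv ℝ f) x v v := by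
  have hline (ε : ℝ) : HasDerivAt (fun ε : ℝ => x + ε • v) v ε := by
    simpa using ((hasDerivAt_id ε).smul_const v).const_add x
  have hfirst : (deriv fun ε : ℝ => f (x + ε • v)) =ᶠ[𝓝 0]
      fun ε : ℝ => fderiv ℝ f (x + ε • v) v := by
    filter_upwards [(tendsto_add_smul_nhds x v).eventually (hf.eventually (by simp))] with ε hε
    exact ((hε.differentiableAt (by simp)).hasFDerivAt.comp_hasDerivAt ε (hline ε)).deriv
  have hfderiv : HasFDerivAt (fderiv ℝ f) (fderiv ℝ (fderiv ℝ f) x) (x + (0 : ℝ) • v) := by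
    simpa using ((hf.fderiv_right (m := 1) (by norm_num)).differentiableAt (by simp)).hasFDerivAt
  rw [iteratedDeriv_succ, iteratedDeriv_one, hfirst.deriv_eq]
  exact ((ContinuousLinearMap.apply ℝ F v).hasFDerivAt.comp_hasDerivAt (0 : ℝ)
    (hfderiv.comp_hasDerivAt (0 : ℝ) (hline 0))).deriv

theorem isBigO_sub_taylor_two_of_analyticAt {f : E → F} {x₀ : E} (hf : AnalyticAt ℝ f x₀)
    [CompleteSpace F] :
    (fun x => f x - (f x₀ + fderiv ℝ f x₀ (x - x₀) +
      (1 / 2 : ℝ) • fderiv ℝ (fderiv ℝ f) x₀ (x - x₀) (x - x₀)))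
      =O[𝓝 x₀] fun x => ‖x - x₀‖ ^ 3 := by
  obtain ⟨p, r, hp⟩ := hf
  have hsub : Tendsto (fun x => x - x₀) (𝓝 x₀) (𝓝 0) := tendsto_sub_nhds_zero_iff.mpr tendsto_id
  refine ((hp.hasFPowerSeriesAt.isBigO_sub_partialSum_pow 3).comp_tendsto hsub).congr
    (fun x => ?_) fun x => rfl
  have hp0 : p 0 (fun _ => x - x₀) = f x₀ := hp.coeff_zero _
  have hp1 : p 1 (fun _ => x - x₀) = fderiv ℝ f x₀ (x - x₀) := by
    simpa [iteratedFDeriv_one_apply] using hp.factorial_smul (x - x₀) 1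
  have hp2 : (2 : ℝ) • p 2 (fun _ => x - x₀) = fderiv ℝ (fderiv ℝ f) x₀ (x - x₀) (x - x₀) := by
    simpa [iteratedFDeriv_two_apply, ← Nat.cast_smul_eq_nsmul ℝ] using
      hp.factorial_smul (x - x₀) 2
  rw [← hp2, smul_smul]
  simp [FormalMultilinearSeries.partialSum, Finset.sum_range_succ, hp0, hp1]

end TaylorTwo

section EffectiveForm

variable {d : ℕ} {F g : EuclideanSpace ℝ (Fin d) → ℝ} {θ₀ : EuclideanSpace ℝ (Fin d)}

theorem effectiveForm_congr (h : F =ᶠ[𝓝 θ₀] g) (ω : EuclideanSpace ℝ (Fin d)) :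
    effectiveForm F θ₀ ω = effectiveForm g θ₀ ω := by
  exact congrArg (1 / 2 * ·) ((h.comp_tendsto (tendsto_add_smul_nhds θ₀ ω)).iteratedDeriv_eq 2)

theorem HasEffectiveForm.congr (hg : HasEffectiveForm g θ₀) (h : F =ᶠ[𝓝 θ₀] g) :
    HasEffectiveForm F θ₀ := by
  refine ⟨fun ω => (hg.1 ω).congr_of_eventuallyEq ((tendsto_add_smul_nhds θ₀ ω).eventually h),
    hg.2.congr' ?_ EventuallyEq.rfl⟩
  filter_upwards [h] with θ hθ
  rw [hθ, h.eq_of_nhds, effectiveForm_congr h]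

theorem effectiveForm_eq_fderiv_fderiv (hF : ContDiffAt ℝ 2 F θ₀)
    (ω : EuclideanSpace ℝ (Fin d)) :
    effectiveForm F θ₀ ω = 1 / 2 * fderiv ℝ (fderiv ℝ F) θ₀ ω ω := by
  rw [effectiveForm, iteratedDeriv_two_add_smul hF]

theorem hasEffectiveForm_of_analyticAt (hF : AnalyticAt ℝ F θ₀) (hcrit : fderiv ℝ F θ₀ = 0) :
    HasEffectiveForm F θ₀ := by
  refine ⟨fun ω => ?_, (isBigO_sub_taylor_two_of_analyticAt hF).congr_left fun θ => ?_⟩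
  · have hF' : ContDiffAt ℝ 2 F (θ₀ + (0 : ℝ) • ω) := by simpa using hF.contDiffAt
    exact hF'.comp (f := fun ε : ℝ => θ₀ + ε • ω) 0 (by fun_prop)
  · rw [effectiveForm_eq_fderiv_fderiv hF.contDiffAt, hcrit]
    rcases eq_or_ne (θ - θ₀) 0 with hθ | hθ
    · simp [hθ]
    · have hnorm : ‖θ - θ₀‖ ≠ 0 := norm_ne_zero_iff.mpr hθ
      simp only [map_smul, smul_apply, zero_apply, smul_eq_mul]
      field_simp
      ring

theorem HasEffectiveForm.tendsto (hF : HasEffectiveForm F θ₀) {ω : EuclideanSpace ℝ (Fin d)}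
    (hω : ‖ω‖ = 1) :
    Tendsto (fun ε : ℝ => (F (θ₀ + ε • ω) - F θ₀) / ε ^ 2) (𝓝[>] 0)
      (𝓝 (effectiveForm F θ₀ ω)) := by
  have hquot : (fun ε : ℝ => (F (θ₀ + ε • ω) - F θ₀) / ε ^ 2 - effectiveForm F θ₀ ω)
      =O[𝓝[>] 0] fun ε : ℝ => ε := by
    refine ((hF.2.comp_tendsto (tendsto_add_smul_nhdsGT θ₀ ω)).mul
      (isBigO_refl (fun ε : ℝ => (ε ^ 2)⁻¹) _)).congr' ?_ ?_
    all_goals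
      filter_upwards [self_mem_nhdsWithin] with ε hε
      have hpos : 0 < ε := hε
      simp only [Function.comp_apply, add_sub_cancel_left, norm_smul, hω, mul_one,
        Real.norm_of_nonneg hpos.le, inv_smul_smul₀ hpos.ne']
      field_simp
    ring
  simpa using (hquot.trans_tendsto (tendsto_id.mono_left nhdsWithin_le_nhds)).add_const
    (effectiveForm F θ₀ ω)

theorem HasEffectiveForm.effectiveForm_comp {φ : ℝ → ℝ} {c : ℝ} (hg : HasEffectiveForm g θ₀)
    (hφg : HasEffectiveForm (fun θ => φ (g θ)) θ₀) (hφ : HasDerivAt φ c (g θ₀))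
    {ω : EuclideanSpace ℝ (Fin d)} (hω : ‖ω‖ = 1) :
    effectiveForm (fun θ => φ (g θ)) θ₀ ω = c * effectiveForm g θ₀ ω := by
  have hlim := hg.tendsto hω
  have hcont : Tendsto (fun ε : ℝ => g (θ₀ + ε • ω)) (𝓝[>] 0) (𝓝 (g θ₀)) := by
    simpa using (hg.1 ω).continuousAt.tendsto.mono_left (nhdsWithin_le_nhds (s := Set.Ioi 0))
  have hquadratic : ((fun x => x - g θ₀) ∘ fun ε : ℝ => g (θ₀ + ε • ω))
      =O[𝓝[>] 0] fun ε : ℝ => ε ^ 2 := by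
    refine isBigO_of_div_tendsto_nhds ?_ _ hlim
    filter_upwards [self_mem_nhdsWithin] with ε hε h
    exact absurd h (pow_ne_zero 2 (ne_of_gt hε))
  have hremainder := (((hasDerivAt_iff_isLittleO.mp hφ).comp_tendsto hcont).trans_isBigO
    hquadratic).tendsto_div_nhds_zero
  refine tendsto_nhds_unique (hφg.tendsto hω) ?_
  refine Tendsto.congr (fun ε => ?_) (zero_add (c * _) ▸ hremainder.add (hlim.const_mul c))
  simp only [Function.comp_apply, smul_eq_mul]
  ring

end EffectiveForm

section ArccosSq

/-- The analytic function `w ↦ ∑ (-w)ⁿ / (2n)!`, whose value at `z ^ 2` is `cos z`. -/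
noncomputable def cosSqrt (w : ℝ) : ℝ :=
  if 0 ≤ w then Real.cos √w else Real.cosh √(-w)

theorem cosSqrt_sq (z : ℝ) : cosSqrt (z ^ 2) = Real.cos z := by
  rw [cosSqrt, if_pos (sq_nonneg z), Real.sqrt_sq_eq_abs, Real.cos_abs]

theorem hasSum_cosSqrt (w : ℝ) :
    HasSum (fun n : ℕ => w ^ n * ((-1) ^ n / (2 * n).factorial)) (cosSqrt w) := by
  unfold cosSqrt
  split_ifs with hw
  · convert Real.hasSum_cos √w using 2 with n
    rw [pow_mul, Real.sq_sqrt hw]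
    ring
  · convert Real.hasSum_cosh √(-w) using 2 with n
    rw [pow_mul, Real.sq_sqrt (by linarith), neg_pow]
    ring

theorem hasFPowerSeriesAt_cosSqrt : HasFPowerSeriesAt cosSqrt
    (FormalMultilinearSeries.ofScalars ℝ fun n : ℕ => (-1 : ℝ) ^ n / (2 * n).factorial) 0 := by
  rw [hasFPowerSeriesAt_iff]
  refine Eventually.of_forall fun w => ?_
  simpa [FormalMultilinearSeries.coeff_ofScalars] using hasSum_cosSqrt w

theorem hasDerivAt_cosSqrt_zero : HasDerivAt cosSqrt (-(1 / 2)) 0 := by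
  have hcoeff := hasFPowerSeriesAt_cosSqrt.hasDerivAt
  norm_num [FormalMultilinearSeries.ofScalars_apply_eq, Nat.factorial] at hcoeff
  exact hcoeff

theorem exists_analyticAt_arccos_sq : ∃ h : ℝ → ℝ, AnalyticAt ℝ h 0 ∧ HasDerivAt h 2 0 ∧
    ∀ᶠ x in 𝓝 (0 : ℝ), 0 ≤ x → Real.arccos (1 - x) ^ 2 = h x := by
  let C : ℝ → ℝ := fun w => 1 - cosSqrt w
  have hC : AnalyticAt ℝ C 0 := analyticAt_const.sub hasFPowerSeriesAt_cosSqrt.analyticAt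
  have hC0 : C 0 = 0 := by simp [C, cosSqrt]
  have hderiv : deriv C 0 = 1 / 2 := by
    rw [(hasDerivAt_cosSqrt_zero.const_sub 1).deriv]
    norm_num
  have hne : deriv C 0 ≠ 0 := by norm_num [hderiv]
  refine ⟨hC.hasStrictDerivAt.localInverse _ _ _ hne, ?_, ?_, ?_⟩
  · simpa only [hC0] using hC.analyticAt_localInverse hne
  · simpa [hC0, hderiv] using (hC.hasStrictDerivAt.to_localInverse hne).hasDerivAt
  · have harccos : Tendsto (fun x : ℝ => Real.arccos (1 - x) ^ 2) (𝓝 0) (𝓝 0) := by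
      have hcont : Continuous fun x : ℝ => Real.arccos (1 - x) ^ 2 := by fun_prop
      simpa using hcont.tendsto 0
    filter_upwards [harccos.eventually (hC.hasStrictDerivAt.eventually_left_inverse hne),
      eventually_le_nhds zero_lt_two] with x hx hx2 hx0
    have hCx : C (Real.arccos (1 - x) ^ 2) = x := by
      simp only [C, cosSqrt_sq]
      rw [Real.cos_arccos (by linarith) (by linarith), sub_sub_cancel]
    rw [← hx, hCx]

end ArccosSq

/-! ### Matrices and quadratic forms -/

section HermitianMatrix

open scoped MatrixOrder ComplexOrder

variable {𝕜 n : Type*} [RCLike 𝕜] [Fintype n] [DecidableEq n] {A : Matrix n n 𝕜}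

theorem map_re_roots_charpoly (hA : A.IsHermitian) :
    A.charpoly.roots.map RCLike.re = Finset.univ.val.map hA.eigenvalues := by
  rw [hA.roots_charpoly_eq_eigenvalues, Multiset.map_map]
  exact Multiset.map_congr rfl fun i _ => RCLike.ofReal_re _

theorem mem_map_re_roots_charpoly_iff (hA : A.IsHermitian) {x : ℝ} :
    x ∈ A.charpoly.roots.map RCLike.re ↔ x ∈ spectrum ℝ A := by
  simp [map_re_roots_charpoly hA, hA.spectrum_real_eq_range_eigenvalues]

theorem finrank_eigenspace_toEuclideanLin (hA : A.IsHermitian) (μ : ℝ) :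
    Module.finrank 𝕜 (Module.End.eigenspace (Matrix.toEuclideanLin A) μ) =
      (A.charpoly.roots.map RCLike.re).count μ := by
  have hsymm : (Matrix.toEuclideanLin A).IsSymmetric :=
    Matrix.isSymmetric_toEuclideanLin_iff.mpr hA
  rw [← hsymm.isFinitelySemisimple.maxGenEigenspace_eq_eigenspace,
    LinearMap.finrank_maxGenEigenspace_eq, Matrix.toEuclideanLin_eq_toLin_orthonormal,
    Matrix.charpoly_toLin, ← Polynomial.count_roots, map_re_roots_charpoly hA,
    hA.roots_charpoly_eq_eigenvalues, ← Multiset.map_map,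
    Multiset.count_map_eq_count' _ _ RCLike.ofReal_injective]

theorem mul_sum_norm_sq_le_re_dotProduct_mulVec (hA : A.IsHermitian) {m : ℝ}
    (hm : ∀ x ∈ spectrum ℝ A, m ≤ x) (x : n → 𝕜) :
    m * ∑ i, ‖x i‖ ^ 2 ≤ RCLike.re (star x ⬝ᵥ A.mulVec x) := by
  have hle : algebraMap ℝ (Matrix n n 𝕜) m ≤ A := algebraMap_le_of_le_spectrum hm hA
  have hnonneg := (Matrix.le_iff.mp hle).re_dotProduct_nonneg x
  have hx : star x ⬝ᵥ x = ((∑ i, ‖x i‖ ^ 2 : ℝ) : 𝕜) := by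
    simp [dotProduct, RCLike.conj_mul]
  rw [Algebra.algebraMap_eq_smul_one] at hnonneg
  simpa [Matrix.sub_mulVec, dotProduct_sub, Matrix.smul_mulVec, hx, RCLike.smul_re] using hnonneg

theorem re_dotProduct_mulVec_le_mul_sum_norm_sq (hA : A.IsHermitian) {M : ℝ}
    (hM : ∀ x ∈ spectrum ℝ A, x ≤ M) (x : n → 𝕜) :
    RCLike.re (star x ⬝ᵥ A.mulVec x) ≤ M * ∑ i, ‖x i‖ ^ 2 := by
  have hneg := mul_sum_norm_sq_le_re_dotProduct_mulVec hA.neg (m := -M) (fun y hy => by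
    rw [← spectrum.neg_eq, Set.mem_neg] at hy
    exact neg_le.mp (hM _ hy)) x
  simpa [Matrix.neg_mulVec] using hneg

end HermitianMatrix

section Gram

open scoped Matrix

variable {m n : Type*} [Fintype m] [Fintype n]

theorem dotProduct_transpose_mul_self_mulVec (T : Matrix m n ℝ) (x : n → ℝ) :
    x ⬝ᵥ (Tᵀ * T) *ᵥ x = ∑ i, (T *ᵥ x) i ^ 2 := by
  rw [← Matrix.mulVec_mulVec, Matrix.dotProduct_mulVec, Matrix.vecMul_transpose, dotProduct]
  simp only [sq]

variable [DecidableEq n]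

theorem mul_sum_sq_le_sum_mulVec_sq {T : Matrix m n ℝ} {l : ℝ}
    (hl : l ∈ lowerBounds (spectrum ℝ (Tᵀ * T))) (x : n → ℝ) :
    l * ∑ i, x i ^ 2 ≤ ∑ i, (T *ᵥ x) i ^ 2 := by
  rw [← dotProduct_transpose_mul_self_mulVec]
  simpa using mul_sum_norm_sq_le_re_dotProduct_mulVec
    (Matrix.isHermitian_conjTranspose_mul_self T) (fun _ => @hl _) x

theorem sum_mulVec_sq_le_mul_sum_sq {T : Matrix m n ℝ} {l : ℝ}
    (hl : l ∈ upperBounds (spectrum ℝ (Tᵀ * T))) (x : n → ℝ) :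
    ∑ i, (T *ᵥ x) i ^ 2 ≤ l * ∑ i, x i ^ 2 := by
  rw [← dotProduct_transpose_mul_self_mulVec]
  simpa using re_dotProduct_mulVec_le_mul_sum_norm_sq
    (Matrix.isHermitian_conjTranspose_mul_self T) (fun _ => @hl _) x

theorem pos_of_mem_spectrum_transpose_mul_self {T : Matrix m n ℝ} {l : ℝ}
    (hT : Function.Injective T.mulVec) (hl : l ∈ spectrum ℝ (Tᵀ * T)) : 0 < l := by
  have hpos : (Tᵀ * T).PosDef := Matrix.PosDef.conjTranspose_mul_self T hT
  rw [hpos.isHermitian.spectrum_real_eq_range_eigenvalues] at hl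
  obtain ⟨i, rfl⟩ := hl
  exact hpos.eigenvalues_pos i

theorem exists_linearIndependent_row_comp {K ι : Type*} [Field K] [Finite ι] {d : ℕ}
    {T : Matrix ι (Fin d) K} (hT : Function.Injective T.mulVec) :
    ∃ b : Fin d → ι, LinearIndependent K fun i => T.row (b i) := by
  have hcol : LinearIndependent K T.transpose.row := Matrix.mulVec_injective_iff.mp hT
  have hfinrank : Module.finrank K (Submodule.span K (Set.range T.row)) = d := by
    cases nonempty_fintype ι
    rw [← Matrix.rank_eq_finrank_span_row, ← Matrix.rank_transpose, hcol.rank_matrix,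
      Fintype.card_fin]
  obtain ⟨f, hf, -, hf_indep⟩ := Submodule.exists_fun_fin_finrank_span_eq K (Set.range T.row)
  choose b hb using hf
  refine ⟨b ∘ Fin.cast hfinrank.symm, ?_⟩
  simp only [Function.comp_apply, hb]
  exact hf_indep.comp (Fin.cast hfinrank.symm) (Fin.cast_injective _)

end Gram

section QuadraticForm

variable {d : ℕ}

theorem posDef_of_forall_norm_eq_one {M : Matrix (Fin d) (Fin d) ℝ} (hM : M.IsHermitian)
    (h : ∀ ω : EuclideanSpace ℝ (Fin d), ‖ω‖ = 1 → 0 < ω.ofLp ⬝ᵥ M.mulVec ω.ofLp) :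
    M.PosDef := by
  refine Matrix.PosDef.of_dotProduct_mulVec_pos hM fun x hx => ?_
  let y : EuclideanSpace ℝ (Fin d) := WithLp.toLp 2 x
  have hy : 0 < ‖y‖⁻¹ := inv_pos.mpr (norm_pos_iff.mpr (by simpa [y] using hx))
  have hunit := h (‖y‖⁻¹ • y) (by rw [norm_smul, norm_inv, norm_norm, inv_mul_cancel₀
    (inv_pos.mp hy).ne'])
  rw [WithLp.ofLp_smul, Matrix.mulVec_smul, dotProduct_smul, smul_dotProduct, smul_eq_mul,
    smul_eq_mul] at hunit
  exact (mul_pos_iff_of_pos_left hy).mp ((mul_pos_iff_of_pos_left hy).mp hunit)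

theorem exists_isHermitian_effectiveForm_eq {F : EuclideanSpace ℝ (Fin d) → ℝ}
    {θ₀ : EuclideanSpace ℝ (Fin d)} (hF : ContDiffAt ℝ 2 F θ₀) :
    ∃ M : Matrix (Fin d) (Fin d) ℝ, M.IsHermitian ∧
      ∀ ω : EuclideanSpace ℝ (Fin d), effectiveForm F θ₀ ω = ω.ofLp ⬝ᵥ M.mulVec ω.ofLp := by
  have hsymm : IsSymmSndFDerivAt ℝ F θ₀ := hF.isSymmSndFDerivAt (by simp)
  let b := (EuclideanSpace.basisFun (Fin d) ℝ).toBasis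
  refine ⟨Matrix.of fun i j => 1 / 2 * fderiv ℝ (fderiv ℝ F) θ₀ (b i) (b j), ?_, fun ω => ?_⟩
  · exact Matrix.IsHermitian.ext fun i j => by simp [hsymm.eq (b i) (b j)]
  · rw [effectiveForm_eq_fderiv_fderiv hF]
    conv_lhs => rw [← b.sum_repr ω]
    simp only [map_sum, map_smul, sum_apply, smul_apply, smul_eq_mul, dotProduct, Matrix.mulVec,
      Matrix.of_apply, Finset.mul_sum]
    rw [Finset.sum_comm]
    refine Finset.sum_congr rfl fun i _ => Finset.sum_congr rfl fun j _ => ?_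
    simp only [b, OrthonormalBasis.coe_toBasis_repr_apply, EuclideanSpace.basisFun_repr]
    ring

end QuadraticForm

/-! ### Ordered roots -/

section OrderedRoots

theorem eq_of_forall_prod_sub_eq {m : ℕ} {L L' : Fin m → ℝ} (hL : Monotone L) (hL' : Monotone L')
    {Z : Set ℝ} (hZ : Z.Finite) (h : ∀ t ∉ Z, ∏ i, (t - L i) = ∏ i, (t - L' i)) : L = L' := by
  let P : (Fin m → ℝ) → Polynomial ℝ := fun L =>
    ((Multiset.ofList (List.ofFn L)).map fun a => Polynomial.X - Polynomial.C a).prod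
  have heval (L : Fin m → ℝ) (t : ℝ) : (P L).eval t = ∏ i, (t - L i) := by
    simp only [P, Multiset.map_coe, Multiset.prod_coe, List.map_ofFn, List.prod_ofFn,
      Function.comp_apply, Polynomial.eval_prod, Polynomial.eval_sub, Polynomial.eval_X,
      Polynomial.eval_C]
  have hP : P L = P L' := by
    refine Polynomial.eq_of_infinite_eval_eq _ _ (hZ.infinite_compl.mono fun t ht => ?_)
    rw [Set.mem_ofPred_eq, heval, heval, h t ht]
  have hroots := congrArg Polynomial.roots hP
  simp only [P, Polynomial.roots_multiset_prod_X_sub_C] at hroots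
  exact List.ofFn_injective <| List.Perm.eq_of_sortedLE hL.sortedLE_ofFn hL'.sortedLE_ofFn
    (Multiset.coe_eq_coe.mp hroots)

-- On the compact set of monotone tuples in `[a, b]ᵐ`, the map to the values of the polynomial is
-- continuous and injective, hence an embedding.
theorem continuous_of_continuous_prod_sub {X : Type*} [TopologicalSpace X] {m : ℕ}
    {L : X → Fin m → ℝ} (hmono : ∀ x, Monotone (L x)) {a b : ℝ}
    (hab : ∀ x i, L x i ∈ Set.Icc a b) {Z : Set ℝ} (hZ : Z.Finite)
    (hcont : ∀ t ∉ Z, Continuous fun x => ∏ i, (t - L x i)) : Continuous L := by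
  let K : Set (Fin m → ℝ) := {Λ | Monotone Λ} ∩ Set.pi Set.univ fun _ => Set.Icc a b
  have hK : IsCompact K := (isCompact_univ_pi fun _ => isCompact_Icc).inter_left isClosed_monotone
  have : CompactSpace K := isCompact_iff_compactSpace.mp hK
  let Φ : K → ({t // t ∉ Z} → ℝ) := fun Λ t => ∏ i, ((t : ℝ) - (Λ : Fin m → ℝ) i)
  have hΦ : IsClosedEmbedding Φ := by
    have hcontΦ : Continuous Φ := continuous_pi fun t => continuous_finsetProd _ fun i _ =>
      continuous_const.sub ((continuous_apply i).comp continuous_subtype_val)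
    refine hcontΦ.isClosedEmbedding fun Λ Λ' h => Subtype.ext ?_
    exact eq_of_forall_prod_sub_eq Λ.2.1 Λ'.2.1 hZ fun t ht => congrFun h ⟨t, ht⟩
  let L' : X → K := fun x => ⟨L x, hmono x, fun i _ => hab x i⟩
  have hL' : Continuous L' :=
    hΦ.isEmbedding.continuous_iff.mpr (continuous_pi fun t => hcont t t.2)
  exact continuous_subtype_val.comp hL'

theorem continuous_getD_sort {X : Type*} [TopologicalSpace X] {S : X → Multiset ℝ} {m : ℕ}
    (hcard : ∀ x, (S x).card = m) {a b : ℝ} (hab : ∀ x, ∀ s ∈ S x, s ∈ Set.Icc a b)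
    {Z : Set ℝ} (hZ : Z.Finite)
    (hcont : ∀ t ∉ Z, Continuous fun x => ((S x).map fun s => t - s).prod) {n : ℕ} (hn : n < m) :
    Continuous fun x => ((S x).sort (· ≤ ·)).getD n 0 := by
  have hlen (x : X) : ((S x).sort (· ≤ ·)).length = m := by rw [Multiset.length_sort, hcard]
  let L : X → Fin m → ℝ := fun x i => ((S x).sort (· ≤ ·)).get (i.cast (hlen x).symm)
  have hL (x : X) : List.ofFn (L x) = (S x).sort (· ≤ ·) :=
    List.ext_get (by simp [hlen]) fun i _ _ => by simp [L]
  have hprod (x : X) (t : ℝ) : ∏ i, (t - L x i) = ((S x).map fun s => t - s).prod := by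
    rw [← List.prod_ofFn, ← (S x).sort_eq (· ≤ ·), ← hL x, Multiset.map_coe, Multiset.prod_coe,
      List.map_ofFn]
    rfl
  have hcontL : Continuous L := by
    refine continuous_of_continuous_prod_sub (a := a) (b := b) (fun x => ?_) (fun x i => ?_) hZ
      fun t ht => by simpa only [hprod] using hcont t ht
    · exact ((S x).pairwise_sort (· ≤ ·)).sortedLE.monotone_get.comp fun i j hij => hij
    · exact hab x _ ((Multiset.mem_sort (r := (· ≤ ·))).mp (List.get_mem _ _))
  convert! (continuous_apply (⟨n, hn⟩ : Fin m)).comp hcontL using 2 with x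
  simp [L, hlen, hn]

theorem exists_hasDerivAt_prod_sub_of_count_eq_one {S : Multiset ℝ} {x : ℝ} (hx : S.count x = 1) :
    ∃ c ≠ 0, HasDerivAt (fun t => (S.map fun s => t - s).prod) c x := by
  let P : Polynomial ℝ := (S.map fun a => Polynomial.X - Polynomial.C a).prod
  have hroots : P.roots = S := Polynomial.roots_multiset_prod_X_sub_C S
  have hP0 : P ≠ 0 := (Polynomial.monic_multisetProd_X_sub_C S).ne_zero
  have heval : (fun t => (S.map fun s => t - s).prod) = fun t => P.eval t := by
    funext t
    simp [P, Polynomial.eval_multiset_prod, Multiset.map_map]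
  have hsimple : P.rootMultiplicity x = 1 := by rw [← Polynomial.count_roots, hroots, hx]
  have hroot : P.IsRoot x := (Polynomial.rootMultiplicity_pos hP0).mp (by lia)
  refine ⟨P.derivative.eval x, fun hderiv => ?_, heval ▸ P.hasDerivAt x⟩
  have := (Polynomial.one_lt_rootMultiplicity_iff_isRoot hP0).mpr ⟨hroot, hderiv⟩
  lia

theorem analyticAt_of_implicit {E : Type*} [NormedAddCommGroup E] [NormedSpace ℝ E]
    [CompleteSpace E] {f : E × ℝ → ℝ} {g : E → ℝ} {x₀ : E} (hg : ContinuousAt g x₀)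
    (hf : ContDiffAt ℝ ⊤ f (x₀, g x₀)) (hzero : ∀ x, f (x, g x) = 0) {c : ℝ} (hc : c ≠ 0)
    (hderiv : HasDerivAt (fun t => f (x₀, t)) c (g x₀)) : AnalyticAt ℝ g x₀ := by
  have hinv : (fderiv ℝ f (x₀, g x₀) ∘L .inr ℝ E ℝ).IsInvertible := by
    refine ⟨ContinuousLinearEquiv.unitsEquivAut ℝ (Units.mk0 c hc), ?_⟩
    have hfderiv : HasFDerivAt f (fderiv ℝ f (x₀, g x₀)) (x₀, g x₀) :=
      (hf.differentiableAt (by simp)).hasFDerivAt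
    have hpartial := (hfderiv.comp_hasDerivAt (g x₀)
      ((hasDerivAt_const _ _).prodMk (hasDerivAt_id _))).unique hderiv
    ext
    simp [← hpartial]
  have himplicit := (hf.contDiffAt_implicitFunction (by simp) hinv).analyticAt
  refine himplicit.congr ?_
  filter_upwards [(continuousAt_id.prodMk hg).tendsto.eventually
    (hf.eventually_apply_eq_iff_implicitFunction (by simp) hinv)] with x hx
  exact hx.mp (by rw [id, hzero, hzero])

end OrderedRoots

section SortedLists

theorem card_getD_pred_eq_count {α : Type*} [DecidableEq α] (l : List α) (default x : α) :
    Nat.card {n : ℕ // 1 ≤ n ∧ n ≤ l.length ∧ l.getD (n - 1) default = x} = l.count x := by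
  have hcount : l.count x = Nat.card {i : Fin l.length // l.get i = x} := by
    have hl : (l : Multiset α) = (Finset.univ : Finset (Fin l.length)).val.map l.get := by
      rw [Fin.univ_val_map, List.ofFn_get]
    rw [← Multiset.coe_count, hl, Multiset.count_map, Nat.card_eq_fintype_card,
      Fintype.card_subtype]
    simp only [eq_comm (a := x)]
    rfl
  have hget (i : Fin l.length) : l.getD i default = l.get i :=
    List.getD_eq_getElem l default i.isLt
  rw [hcount]
  refine Nat.card_congr
    { toFun := fun n => ⟨⟨n.1 - 1, by have := n.2; lia⟩, (hget _).symm.trans n.2.2.2⟩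
      invFun := fun i => ⟨i.1 + 1, by lia, by lia, (hget i.1).trans i.2⟩
      left_inv := fun n => Subtype.ext (Nat.sub_add_cancel n.2.1)
      right_inv := fun i => Subtype.ext (Fin.ext (Nat.add_sub_cancel ..)) }

theorem getD_zero_le_of_mem {α : Type*} [Preorder α] {l : List α} (hl : l.Pairwise (· ≤ ·))
    (default : α) {x : α} (hx : x ∈ l) : l.getD 0 default ≤ x := by
  cases l with
  | nil => exact absurd hx List.not_mem_nil
  | cons a l =>
    rcases List.mem_cons.mp hx with rfl | hx_tail
    · exact le_rfl
    · exact List.rel_of_pairwise_cons hl hx_tail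

end SortedLists

/-! ### The equation on an edge -/

section Ode

open MeasureTheory Set

theorem memLp_restrict_Icc_of_continuous {E : Type*} [NormedAddCommGroup E]
    [SecondCountableTopology E] {f : ℝ → E} (hf : Continuous f) (a b : ℝ) (q : ENNReal) :
    MemLp f q (volume.restrict (Icc a b)) := by
  obtain ⟨C, hC⟩ := (isCompact_Icc (a := a) (b := b)).exists_bound_of_continuousOn hf.continuousOn
  exact MemLp.of_bound hf.aestronglyMeasurable C (ae_restrict_of_forall_mem measurableSet_Icc hC)

theorem hasDerivWithinAt_Icc_of_eq_sub_integral {E : Type*} [NormedAddCommGroup E]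
    [NormedSpace ℝ E] [CompleteSpace E] {a b : ℝ} {p w : ℝ → E} (hw : ContinuousOn w (Icc a b))
    (hp : ∀ t ∈ Icc a b, p t = p a - ∫ x in a..t, w x) {t : ℝ} (ht : t ∈ Icc a b) :
    HasDerivWithinAt p (-w t) (Icc a b) t := by
  have : Fact (t ∈ Icc a b) := ⟨ht⟩
  have hint : IntervalIntegrable w volume a t :=
    (hw.mono (uIcc_of_le ht.1 ▸ Icc_subset_Icc_right ht.2)).intervalIntegrable
  have hmeas : StronglyMeasurableAtFilter w (𝓝[Icc a b] t) :=
    hw.stronglyMeasurableAtFilter_nhdsWithin measurableSet_Icc t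
  exact ((intervalIntegral.integral_hasDerivWithinAt_right hint hmeas (hw t ht)).const_sub
    (p a)).congr hp (hp t ht)

/-- A fundamental system of the equation `-f'' = E f`, normalized at `0`, without Dirichlet
eigenvalue `E` on the unit interval. The derivative of `c` is written as `-E s`. -/
structure IsFundamentalSystem (E : ℝ) (c s : ℝ → ℝ) : Prop where
  deriv_c : ∀ t, HasDerivAt c (-(E * s t)) t
  deriv_s : ∀ t, HasDerivAt s (c t) t
  c_zero : c 0 = 1
  s_zero : s 0 = 0
  s_one : s 1 ≠ 0

namespace IsFundamentalSystem

variable {E : ℝ} {c s : ℝ → ℝ}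

theorem continuous_c (h : IsFundamentalSystem E c s) : Continuous c :=
  continuous_iff_continuousAt.mpr fun t => (h.deriv_c t).continuousAt

theorem continuous_s (h : IsFundamentalSystem E c s) : Continuous s :=
  continuous_iff_continuousAt.mpr fun t => (h.deriv_s t).continuousAt

theorem hasDerivAt_ofReal_c (h : IsFundamentalSystem E c s) (t : ℝ) :
    HasDerivAt (fun t => (c t : ℂ)) (-(E * s t)) t := by
  simpa using (h.deriv_c t).ofReal_comp

theorem hasDerivAt_ofReal_s (h : IsFundamentalSystem E c s) (t : ℝ) :
    HasDerivAt (fun t => (s t : ℂ)) (c t) t :=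
  (h.deriv_s t).ofReal_comp

theorem sq_add_mul_sq (h : IsFundamentalSystem E c s) (t : ℝ) : c t ^ 2 + E * s t ^ 2 = 1 := by
  have hderiv (t : ℝ) : HasDerivAt (fun t => c t ^ 2 + E * s t ^ 2) 0 t := by
    refine (((h.deriv_c t).pow 2).add (((h.deriv_s t).pow 2).const_mul E)).congr_deriv ?_
    push_cast
    ring
  have hconst := is_const_of_deriv_eq_zero (fun t => (hderiv t).differentiableAt)
    (fun t => (hderiv t).deriv) t 0
  simpa [h.c_zero, h.s_zero] using hconst

theorem ofReal_sq_add_mul_sq (h : IsFundamentalSystem E c s) (t : ℝ) :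
    (c t : ℂ) ^ 2 + E * (s t : ℂ) ^ 2 = 1 :=
  mod_cast congrArg Complex.ofReal (h.sq_add_mul_sq t)

theorem hasDerivAt_combination (h : IsFundamentalSystem E c s) (a b : ℂ) (t : ℝ) :
    HasDerivAt (fun t => a * c t + b * s t) (a * (-(E * s t)) + b * c t) t :=
  ((h.hasDerivAt_ofReal_c t).const_mul a).add ((h.hasDerivAt_ofReal_s t).const_mul b)

theorem hasDerivAt_deriv_combination (h : IsFundamentalSystem E c s) (a b : ℂ) (t : ℝ) :
    HasDerivAt (fun t => a * (-(E * s t)) + b * c t) (-(E * (a * c t + b * s t))) t := by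
  refine ((((h.hasDerivAt_ofReal_s t).const_mul (E : ℂ)).neg.const_mul a).add
    ((h.hasDerivAt_ofReal_c t).const_mul b)).congr_deriv ?_
  ring

theorem integral_combination (h : IsFundamentalSystem E c s) (a b : ℂ) (t : ℝ) :
    ∫ x in (0 : ℝ)..t, E * (a * c x + b * s x) = b - (a * (-(E * s t)) + b * c t) := by
  have hc := h.continuous_c
  have hs := h.continuous_s
  rw [intervalIntegral.integral_eq_sub_of_hasDerivAt
    (fun x _ => (h.hasDerivAt_deriv_combination a b x).neg.congr_deriv (neg_neg _))
    (Continuous.intervalIntegrable (by fun_prop) _ _)]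
  simp only [Pi.neg_apply, h.c_zero, h.s_zero]
  push_cast
  ring

theorem eq_combination (h : IsFundamentalSystem E c s) {f p : ℝ → ℂ}
    (hf : ∀ t ∈ Icc (0 : ℝ) 1, HasDerivWithinAt f (p t) (Icc 0 1) t)
    (hp : ∀ t ∈ Icc (0 : ℝ) 1, p t = p 0 - ∫ x in (0 : ℝ)..t, E * f x)
    {t : ℝ} (ht : t ∈ Icc (0 : ℝ) 1) :
    f t = f 0 * c t + p 0 * s t ∧ p t = f 0 * (-(E * s t)) + p 0 * c t := by
  have hfc : ContinuousOn f (Icc 0 1) := fun t ht => (hf t ht).continuousWithinAt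
  have hp' (t : ℝ) (ht : t ∈ Icc (0 : ℝ) 1) : HasDerivWithinAt p (-(E * f t)) (Icc 0 1) t :=
    hasDerivWithinAt_Icc_of_eq_sub_integral (continuousOn_const.mul hfc) hp ht
  have hconst (w : ℝ → ℂ) (hw : ∀ t ∈ Icc (0 : ℝ) 1, HasDerivWithinAt w 0 (Icc 0 1) t) :
      w t = w 0 :=
    constant_of_derivWithin_zero (fun x hx => (hw x hx).differentiableWithinAt)
      (fun x hx => (hw x (Ico_subset_Icc_self hx)).derivWithin
        (uniqueDiffOn_Icc zero_lt_one x (Ico_subset_Icc_self hx))) t ht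
  -- The Wronskians of `f` with `s` and with `c` are constant.
  have hws := hconst (fun t => f t * c t - p t * s t) fun x hx => by
    refine (((hf x hx).mul (h.hasDerivAt_ofReal_c x).hasDerivWithinAt).sub
      ((hp' x hx).mul (h.hasDerivAt_ofReal_s x).hasDerivWithinAt)).congr_deriv ?_
    ring
  have hwc := hconst (fun t => p t * c t + E * (f t * s t)) fun x hx => by
    refine (((hp' x hx).mul (h.hasDerivAt_ofReal_c x).hasDerivWithinAt).add
      (((hf x hx).mul (h.hasDerivAt_ofReal_s x).hasDerivWithinAt).const_mul (E : ℂ))).congr_deriv ?_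
    ring
  simp only [h.c_zero, h.s_zero, Complex.ofReal_one, Complex.ofReal_zero, mul_one, mul_zero,
    sub_zero, add_zero] at hws hwc
  rw [← hws, ← hwc]
  constructor
  · linear_combination -f t * h.ofReal_sq_add_mul_sq t
  · linear_combination -p t * h.ofReal_sq_add_mul_sq t

/-- The slope at `0` of the solution of `-f'' = E f` with `f 0 = y₀` and `f 1 = y₁`. -/
noncomputable def initialSlope (c s : ℝ → ℝ) (y₀ y₁ : ℂ) : ℂ := (s 1 : ℂ)⁻¹ * (y₁ - c 1 * y₀)

theorem combination_one_eq_iff (h : IsFundamentalSystem E c s) {y₀ y₁ b : ℂ} :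
    y₀ * c 1 + b * s 1 = y₁ ↔ b = initialSlope c s y₀ y₁ := by
  have hs : (s 1 : ℂ) ≠ 0 := Complex.ofReal_ne_zero.mpr h.s_one
  rw [initialSlope, eq_inv_mul_iff_mul_eq₀ hs, eq_sub_iff_add_eq]
  constructor <;> intro hb <;> linear_combination hb

theorem deriv_combination_one (h : IsFundamentalSystem E c s) (y₀ y₁ : ℂ) :
    y₀ * (-(E * s 1)) + initialSlope c s y₀ y₁ * c 1 = (s 1 : ℂ)⁻¹ * (c 1 * y₁ - y₀) := by
  have hs : (s 1 : ℂ) ≠ 0 := Complex.ofReal_ne_zero.mpr h.s_one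
  rw [initialSlope]
  field_simp
  linear_combination -y₀ * h.ofReal_sq_add_mul_sq 1

end IsFundamentalSystem

theorem isFundamentalSystem_of_pos {z : ℝ} (hz : 0 < z) (hsin : Real.sin z ≠ 0) :
    IsFundamentalSystem (z ^ 2) (fun t => Real.cos (z * t)) fun t => Real.sin (z * t) / z where
  deriv_c t := by
    refine ((hasDerivAt_id t).const_mul z).cos.congr_deriv ?_
    simp only [id]
    field_simp
  deriv_s t := by
    refine (((hasDerivAt_id t).const_mul z).sin.div_const z).congr_deriv ?_
    simp only [id]
    field_simp
  c_zero := by simp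
  s_zero := by simp
  s_one := by simpa using ⟨hsin, hz.ne'⟩

theorem isFundamentalSystem_zero : IsFundamentalSystem 0 (fun _ => 1) fun t => t where
  deriv_c t := by simpa using hasDerivAt_const t (1 : ℝ)
  deriv_s t := hasDerivAt_id t
  c_zero := rfl
  s_zero := rfl
  s_one := one_ne_zero

theorem isFundamentalSystem_of_neg {z : ℝ} (hz : 0 < z) :
    IsFundamentalSystem (-z ^ 2) (fun t => Real.cosh (z * t)) fun t => Real.sinh (z * t) / z where
  deriv_c t := by
    refine ((hasDerivAt_id t).const_mul z).cosh.congr_deriv ?_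
    simp only [id]
    field_simp
  deriv_s t := by
    refine (((hasDerivAt_id t).const_mul z).sinh.div_const z).congr_deriv ?_
    simp only [id]
    field_simp
  c_zero := by simp
  s_zero := by simp
  s_one := by simpa using hz.ne'

end Ode

section FoldedAngle

/-- The unique `z ∈ [πj, π(j + 1)]` with `cos z = cos a`, for `a ∈ [0, π]`: it turns
`z_n = arccos (1 - λ_n)` into `z_{n,j}`. -/
noncomputable def foldedAngle (j : ℕ) (a : ℝ) : ℝ :=
  if Even j then a + Real.pi * j else (Real.pi - a) + Real.pi * j

theorem cos_foldedAngle (j : ℕ) (a : ℝ) : Real.cos (foldedAngle j a) = Real.cos a := by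
  rw [foldedAngle]
  split_ifs with hj
  · rw [mul_comm, Real.cos_add_nat_mul_pi, hj.neg_one_pow, one_mul]
  · rw [mul_comm, Real.cos_add_nat_mul_pi, (Nat.not_even_iff_odd.mp hj).neg_one_pow,
      Real.cos_pi_sub, neg_one_mul, neg_neg]

theorem sin_foldedAngle (j : ℕ) (a : ℝ) : Real.sin (foldedAngle j a) = (-1) ^ j * Real.sin a := by
  rw [foldedAngle]
  split_ifs
  · rw [mul_comm, Real.sin_add_nat_mul_pi]
  · rw [mul_comm, Real.sin_add_nat_mul_pi, Real.sin_pi_sub]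

theorem hasDerivAt_foldedAngle (j : ℕ) (a : ℝ) : HasDerivAt (foldedAngle j) ((-1) ^ j) a := by
  unfold foldedAngle
  split_ifs with hj
  · rw [hj.neg_one_pow]
    exact (hasDerivAt_id a).add_const _
  · rw [(Nat.not_even_iff_odd.mp hj).neg_one_pow]
    exact ((hasDerivAt_id a).const_sub Real.pi).add_const _

theorem analyticAt_foldedAngle (j : ℕ) (a : ℝ) : AnalyticAt ℝ (foldedAngle j) a := by
  unfold foldedAngle
  split_ifs <;> fun_prop

theorem foldedAngle_mem_Icc (j : ℕ) {a : ℝ} (ha : a ∈ Set.Icc 0 Real.pi) :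
    foldedAngle j a ∈ Set.Icc (Real.pi * j) (Real.pi * (j + 1)) := by
  obtain ⟨ha_nonneg, ha_le⟩ := ha
  rw [foldedAngle]
  split_ifs <;> constructor <;> linarith

theorem foldedAngle_nonneg (j : ℕ) {a : ℝ} (ha : a ∈ Set.Icc 0 Real.pi) : 0 ≤ foldedAngle j a :=
  (by positivity : (0 : ℝ) ≤ Real.pi * j).trans (foldedAngle_mem_Icc j ha).1

theorem foldedAngle_eq_of_cos_eq {j : ℕ} {a z : ℝ} (ha : a ∈ Set.Icc 0 Real.pi)
    (hz : z ∈ Set.Icc (Real.pi * j) (Real.pi * (j + 1))) (hcos : Real.cos z = Real.cos a) :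
    foldedAngle j a = z := by
  obtain ⟨ha_nonneg, ha_le⟩ := ha
  obtain ⟨hz_ge, hz_le⟩ := hz
  have hw : z - j * Real.pi ∈ Set.Icc 0 Real.pi := ⟨by linarith, by linarith⟩
  have hcos_sub : Real.cos (z - j * Real.pi) = (-1) ^ j * Real.cos a := by
    rw [Real.cos_sub_nat_mul_pi, hcos]
  rw [foldedAngle]
  split_ifs with hj
  · rw [hj.neg_one_pow, one_mul] at hcos_sub
    linarith [Real.injOn_cos hw ⟨ha_nonneg, ha_le⟩ hcos_sub]
  · rw [(Nat.not_even_iff_odd.mp hj).neg_one_pow, neg_one_mul, ← Real.cos_pi_sub] at hcos_sub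
    linarith [Real.injOn_cos hw ⟨by linarith, by linarith⟩ hcos_sub]

theorem foldedAngle_eq_iff {j : ℕ} {a z : ℝ} (ha : a ∈ Set.Icc 0 Real.pi) (hz : 0 ≤ z)
    (hk : ∀ k : ℕ, z ≠ Real.pi * (k + 1)) :
    foldedAngle j a = z ↔ j = ⌊z / Real.pi⌋₊ ∧ Real.cos z = Real.cos a := by
  have hpi := Real.pi_pos
  rw [eq_comm (a := j), Nat.floor_eq_iff (div_nonneg hz hpi.le), le_div_iff₀' hpi,
    div_lt_iff₀' hpi]
  constructor
  · rintro rfl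
    have hmem := foldedAngle_mem_Icc j ha
    exact ⟨⟨hmem.1, lt_of_le_of_ne hmem.2 (hk j)⟩, cos_foldedAngle j a⟩
  · rintro ⟨⟨hz_ge, hz_lt⟩, hcos⟩
    exact foldedAngle_eq_of_cos_eq ha ⟨hz_ge, hz_lt.le⟩ hcos

theorem arccos_mem_Icc (x : ℝ) : Real.arccos x ∈ Set.Icc 0 Real.pi :=
  ⟨Real.arccos_nonneg x, Real.arccos_le_pi x⟩

theorem sin_ne_zero_of_sq_ne {z : ℝ} (hz : z ≠ 0)
    (hk : ∀ k : ℤ, k ≠ 0 → z ^ 2 ≠ (Real.pi * k) ^ 2) : Real.sin z ≠ 0 := by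
  intro hsin
  obtain ⟨k, rfl⟩ := Real.sin_eq_zero_iff.mp hsin
  refine hk k (fun hk_zero => hz ?_) (by rw [mul_comm])
  rw [hk_zero, Int.cast_zero, zero_mul]

/-- The band function `E_{n,j}` as a function of `x = λ_n`. -/
noncomputable def metricEnergy (j : ℕ) (x : ℝ) : ℝ :=
  foldedAngle j (Real.arccos (1 - x)) ^ 2

theorem analyticAt_metricEnergy (j : ℕ) {x : ℝ} (hx : x ∈ Set.Ioo 0 2) :
    AnalyticAt ℝ (metricEnergy j) x := by
  have harccos : AnalyticAt ℝ Real.arccos (1 - x) :=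
    (Real.contDiffAt_arccos (by linarith [hx.2]) (by linarith [hx.1])).analyticAt
  exact ((analyticAt_foldedAngle j _).comp
    (harccos.comp (f := fun x : ℝ => 1 - x) (by fun_prop))).pow 2

theorem hasDerivAt_metricEnergy (j : ℕ) {x : ℝ} (hx : x ∈ Set.Ioo 0 2) :
    HasDerivAt (metricEnergy j) (2 * foldedAngle j (Real.arccos (1 - x)) /
      Real.sin (foldedAngle j (Real.arccos (1 - x)))) x := by
  have harccos := (Real.hasDerivAt_arccos (x := 1 - x) (by linarith [hx.2])
    (by linarith [hx.1])).comp x ((hasDerivAt_id x).const_sub 1)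
  refine (((hasDerivAt_foldedAngle j _).comp x harccos).pow 2).congr_deriv ?_
  have hsign : ((-1 : ℝ) ^ j)⁻¹ = (-1) ^ j := by rw [← inv_pow, inv_neg_one]
  simp only [sin_foldedAngle, Real.sin_arccos, div_eq_mul_inv, mul_inv, hsign, Nat.cast_ofNat,
    Nat.add_one_sub_one, pow_one, Function.comp_apply]
  ring

end FoldedAngle

/-! ### The fundamental graph and its Laplacian -/

theorem norm_sub_sq_le_length_add_one_mul {W E : Type*} [SeminormedAddCommGroup E]
    {H : SimpleGraph W} (ψ : W → E) {u w : W} (p : H.Walk u w) (z : E) :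
    ‖z - ψ w‖ ^ 2 ≤ (p.length + 1) *
      (‖z - ψ u‖ ^ 2 + (p.darts.map fun a => ‖ψ a.fst - ψ a.snd‖ ^ 2).sum) := by
  induction p generalizing z with
  | nil => simp
  | @cons u v w hadj p ih =>
    rw [SimpleGraph.Walk.darts_cons, List.map_cons, List.sum_cons, SimpleGraph.Walk.length_cons,
      Nat.cast_add_one]
    have htriangle := norm_sub_le_norm_sub_add_norm_sub z (ψ u) (ψ w)
    have hlength : (0 : ℝ) < p.length + 1 := by positivity
    refine (pow_le_pow_left₀ (norm_nonneg _) htriangle 2).trans ?_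
    refine le_of_mul_le_mul_left ?_ hlength
    nlinarith [ih (ψ u), sq_nonneg ((p.length + 1) * ‖z - ψ u‖ - ‖ψ u - ψ w‖)]

section Character

variable {d : ℕ} (θ : EuclideanSpace ℝ (Fin d)) (m n : Fin d → ℤ)

/-- The pairing `⟨m, θ⟩` of a lattice vector with a quasimomentum. -/
def latticePairing (m : Fin d → ℤ) (θ : EuclideanSpace ℝ (Fin d)) : ℝ := ∑ i, (m i : ℝ) * θ i

/-- The character `m ↦ e^{i⟨m,θ⟩}` of `ℤ^d`. -/
noncomputable def character (θ : EuclideanSpace ℝ (Fin d)) (m : Fin d → ℤ) : ℂ :=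
  Complex.exp (latticePairing m θ * Complex.I)

theorem latticePairing_add :
    latticePairing (m + n) θ = latticePairing m θ + latticePairing n θ := by
  simp only [latticePairing, Pi.add_apply, Int.cast_add, add_mul, Finset.sum_add_distrib]

theorem latticePairing_smul (c : ℝ) : latticePairing m (c • θ) = c * latticePairing m θ := by
  simp only [latticePairing, PiLp.smul_apply, smul_eq_mul, Finset.mul_sum, mul_left_comm c]

theorem latticePairing_single_one (i : Fin d) : latticePairing (Pi.single i 1) θ = θ i := by
  rw [latticePairing, Finset.sum_eq_single i (fun k _ hk => by simp [hk]) (by simp)]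
  simp

theorem character_add : character θ (m + n) = character θ m * character θ n := by
  rw [character, latticePairing_add, Complex.ofReal_add, add_mul, Complex.exp_add]
  rfl

theorem norm_character : ‖character θ m‖ = 1 :=
  Complex.norm_exp_ofReal_mul_I _

theorem character_zero : character 0 m = 1 := by
  simp [character, latticePairing]

theorem tendsto_norm_character_sub_one :
    Tendsto (fun ε : ℝ => ‖character (0 + ε • θ) m - 1‖ ^ 2 / ε ^ 2) (𝓝[>] 0)
      (𝓝 (latticePairing m θ ^ 2)) := by
  have hderiv : HasDerivAt (fun ε : ℝ => Complex.exp ((ε * latticePairing m θ : ℝ) * Complex.I))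
      (latticePairing m θ * Complex.I) 0 := by
    simpa using
      (((hasDerivAt_id (0 : ℝ)).mul_const _).ofReal_comp.mul_const Complex.I).cexp
  have hnorm : ‖(latticePairing m θ : ℂ) * Complex.I‖ ^ 2 = latticePairing m θ ^ 2 := by
    rw [norm_mul, Complex.norm_I, mul_one, Complex.norm_real, Real.norm_eq_abs, sq_abs]
  rw [← hnorm]
  refine (hderiv.tendsto_slope_zero_right.norm.pow 2).congr fun ε => ?_
  rw [zero_add, zero_add, character, latticePairing_smul, zero_mul, Complex.ofReal_zero, zero_mul,
    Complex.exp_zero, norm_smul, mul_pow, norm_inv, inv_pow, Real.norm_eq_abs, sq_abs,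
    inv_mul_eq_div]

end Character

namespace PeriodicGraph

variable {d : ℕ} {V A : Type*} [AddAction (Fin d → ℤ) V] [AddAction (Fin d → ℤ) A]
  {G : PeriodicGraph d V A}

section FundamentalGraph

/-- The class of a vertex in the fundamental graph. -/
def vclass (G : PeriodicGraph d V A) (v : V) : G.FundVertex :=
  (Quotient.mk'' v : AddAction.orbitRel.Quotient (Fin d → ℤ) V)

/-- The class of an oriented edge in the fundamental graph. -/
def eclass (G : PeriodicGraph d V A) (a : A) : G.FundEdge := Quotient.mk'' a

theorem vclass_surjective : Function.Surjective G.vclass := Quotient.mk''_surjective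

theorem eclass_surjective : Function.Surjective G.eclass := Quotient.mk''_surjective

theorem vclass_vadd (m : Fin d → ℤ) (v : V) : G.vclass (m +ᵥ v) = G.vclass v :=
  Quotient.sound' ⟨m, rfl⟩

theorem eclass_vadd (m : Fin d → ℤ) (a : A) : G.eclass (m +ᵥ a) = G.eclass a :=
  Quotient.sound' ⟨m, rfl⟩

theorem vclass_eq_iff {u v : V} : G.vclass u = G.vclass v ↔ ∃ m : Fin d → ℤ, m +ᵥ v = u :=
  Quotient.eq''

theorem fsrc_eclass (a : A) : G.fsrc (G.eclass a) = G.vclass (G.src a) := rfl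

theorem ftgt_eclass (a : A) : G.ftgt (G.eclass a) = G.vclass (G.tgt a) := rfl

theorem finv_eclass (a : A) : G.finv (G.eclass a) = G.eclass (G.inv a) := rfl

theorem index_eclass (V₀ : G.FundamentalVertexSet) (a : A) :
    index V₀ (G.eclass a) = coord V₀ (G.tgt a) - coord V₀ (G.src a) := rfl

theorem tgt_inv (a : A) : G.tgt (G.inv a) = G.src a := by
  rw [← G.src_inv, G.inv_inv]

theorem fsrc_finv (e : G.FundEdge) : G.fsrc (G.finv e) = G.ftgt e := by
  obtain ⟨a, rfl⟩ := eclass_surjective e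
  rw [finv_eclass, fsrc_eclass, ftgt_eclass, G.src_inv]

theorem ftgt_finv (e : G.FundEdge) : G.ftgt (G.finv e) = G.fsrc e := by
  obtain ⟨a, rfl⟩ := eclass_surjective e
  rw [finv_eclass, fsrc_eclass, ftgt_eclass, tgt_inv]

theorem finv_involutive : Function.Involutive G.finv := fun e => by
  obtain ⟨a, rfl⟩ := eclass_surjective e
  rw [finv_eclass, finv_eclass, G.inv_inv]

theorem index_finv (V₀ : G.FundamentalVertexSet) (e : G.FundEdge) :
    index V₀ (G.finv e) = -index V₀ e := by
  obtain ⟨a, rfl⟩ := eclass_surjective e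
  rw [finv_eclass, index_eclass, index_eclass, G.src_inv, tgt_inv, neg_sub]

theorem pairing_finv (V₀ : G.FundamentalVertexSet) (e : G.FundEdge)
    (θ : EuclideanSpace ℝ (Fin d)) : pairing V₀ (G.finv e) θ = -pairing V₀ e θ := by
  simp [pairing, index_finv]

theorem pairing_smul (V₀ : G.FundamentalVertexSet) (e : G.FundEdge) (c : ℝ)
    (θ : EuclideanSpace ℝ (Fin d)) : pairing V₀ e (c • θ) = c * pairing V₀ e θ :=
  latticePairing_smul θ (index V₀ e) c

theorem sum_finv {M : Type*} [AddCommMonoid M] (f : G.FundEdge → M) :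
    ∑ e, f (G.finv e) = ∑ e, f e :=
  Equiv.sum_comp finv_involutive.toPerm f

theorem mem_carrier_finv_iff (O : G.Orientation) (e : G.FundEdge) :
    G.finv e ∈ O.carrier ↔ e ∉ O.carrier := by
  rw [O.mem_iff, finv_involutive]

open Classical in
theorem sum_eq_sum_orientation {M : Type*} [AddCommMonoid M] (O : G.Orientation)
    (f : G.FundEdge → M) : ∑ e, f e = ∑ e : O.carrier, (f e + f (G.finv e)) := by
  have hcarrier (g : G.FundEdge → M) : ∑ e : O.carrier, g e = ∑ e with e ∈ O.carrier, g e :=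
    (Finset.sum_subtype _ (by simp) g).symm
  rw [Finset.sum_add_distrib, hcarrier f, hcarrier fun e => f (G.finv e),
    ← Finset.sum_filter_add_sum_filter_not Finset.univ (fun e => e ∈ O.carrier) f]
  congr 1
  refine Finset.sum_equiv finv_involutive.toPerm (fun e => ?_) fun e _ => ?_
  · simp [mem_carrier_finv_iff]
  · simp [finv_involutive e]

theorem sum_deg_mul (f : G.FundVertex → ℝ) : ∑ v, (G.deg v : ℝ) * f v = ∑ e, f (G.fsrc e) := by
  rw [← Finset.sum_fiberwise (s := Finset.univ) (g := G.fsrc)]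
  refine Finset.sum_congr rfl fun v _ => ?_
  rw [Finset.sum_congr rfl (g := fun _ => f v) (fun e he => by rw [(Finset.mem_filter.mp he).2]),
    Finset.sum_const, nsmul_eq_mul]
  rfl

theorem deg_pos [NeZero d] (v : G.FundVertex) : 0 < G.deg v := by
  obtain ⟨x, rfl⟩ := vclass_surjective v
  have hne : (1 : Fin d → ℤ) +ᵥ x ≠ x := fun h => one_ne_zero (G.free 1 x h)
  rcases Relation.ReflTransGen.cases_head (G.connected x ((1 : Fin d → ℤ) +ᵥ x)) with
    h | ⟨y, ⟨a, ha, -⟩, -⟩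
  · exact absurd h.symm hne
  · exact Finset.card_pos.mpr ⟨G.eclass a, by simp [fsrc_eclass, ha]⟩

theorem sqrt_deg_ne_zero [NeZero d] (v : G.FundVertex) : (√(G.deg v) : ℂ) ≠ 0 :=
  Complex.ofReal_ne_zero.mpr (Real.sqrt_pos.mpr (Nat.cast_pos.mpr (deg_pos v))).ne'

theorem sqrt_deg_sq (v : G.FundVertex) : (√(G.deg v) : ℂ) ^ 2 = G.deg v :=
  mod_cast congrArg Complex.ofReal (Real.sq_sqrt (Nat.cast_nonneg (G.deg v)))

theorem totalDeg_pos [NeZero d] : 0 < G.totalDeg := by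
  obtain ⟨x⟩ := G.nonempty
  exact Finset.sum_pos (fun v _ => deg_pos v) ⟨G.vclass x, Finset.mem_univ _⟩

theorem nu_pos : 0 < G.nu := by
  obtain ⟨x⟩ := G.nonempty
  exact Fintype.card_pos_iff.mpr ⟨G.vclass x⟩

end FundamentalGraph

section Hopping

/-- The phase `e^{i⟨τ(e),θ⟩}` of an oriented edge. -/
noncomputable def phase (V₀ : G.FundamentalVertexSet) (θ : EuclideanSpace ℝ (Fin d))
    (e : G.FundEdge) : ℂ :=
  Complex.exp (Complex.I * (pairing V₀ e θ : ℝ))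

/-- The hopping operator `A(θ)`: the adjacency operator of the fundamental graph, twisted by the
phases of the edges. -/
noncomputable def hop (V₀ : G.FundamentalVertexSet) (θ : EuclideanSpace ℝ (Fin d)) :
    (G.FundVertex → ℂ) →ₗ[ℂ] (G.FundVertex → ℂ) :=
  LinearMap.pi fun v => ∑ e with G.fsrc e = v, phase V₀ θ e • LinearMap.proj (G.ftgt e)

/-- The space of all `Y` with `A(θ) Y = κ D Y`, where `D` is the multiplication by the degree. -/
noncomputable def hopEigenspace (V₀ : G.FundamentalVertexSet) (θ : EuclideanSpace ℝ (Fin d))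
    (κ : ℝ) : Submodule ℂ (G.FundVertex → ℂ) :=
  LinearMap.eqLocus (hop V₀ θ)
    (LinearMap.pi fun v => (κ * G.deg v : ℂ) • LinearMap.proj v)

variable (V₀ : G.FundamentalVertexSet) (θ : EuclideanSpace ℝ (Fin d))

theorem phase_eq_character (e : G.FundEdge) : phase V₀ θ e = character θ (index V₀ e) := by
  rw [phase, mul_comm]
  rfl

theorem phase_finv_eq_exp_neg (e : G.FundEdge) :
    phase V₀ θ (G.finv e) = Complex.exp (-(Complex.I * (pairing V₀ e θ : ℝ))) := by
  simp [phase, pairing_finv]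

theorem phase_finv (e : G.FundEdge) : phase V₀ θ (G.finv e) = star (phase V₀ θ e) := by
  rw [phase_finv_eq_exp_neg, phase, RCLike.star_def, ← Complex.exp_conj]
  simp

theorem norm_phase (e : G.FundEdge) : ‖phase V₀ θ e‖ = 1 := by
  rw [phase_eq_character, norm_character]

theorem phase_finv_mul (e : G.FundEdge) : phase V₀ θ (G.finv e) * phase V₀ θ e = 1 := by
  rw [phase_finv, RCLike.star_def, Complex.conj_mul', norm_phase, Complex.ofReal_one, one_pow]

theorem phase_zero (e : G.FundEdge) : phase V₀ 0 e = 1 := by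
  rw [phase_eq_character, character_zero]

theorem hop_apply (Y : G.FundVertex → ℂ) (v : G.FundVertex) :
    hop V₀ θ Y v = ∑ e with G.fsrc e = v, phase V₀ θ e * Y (G.ftgt e) := by
  simp [hop]

variable {V₀ θ} in
theorem mem_hopEigenspace_iff {κ : ℝ} {Y : G.FundVertex → ℂ} :
    Y ∈ hopEigenspace V₀ θ κ ↔ ∀ v, hop V₀ θ Y v = κ * G.deg v * Y v := by
  simp [hopEigenspace, funext_iff]

theorem floquet_isHermitian : (floquet V₀ θ).IsHermitian := by
  refine Matrix.IsHermitian.ext fun u v => ?_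
  have hphases : ∑ e with G.fsrc e = v ∧ G.ftgt e = u, star (phase V₀ θ e) =
      ∑ e with G.fsrc e = u ∧ G.ftgt e = v, phase V₀ θ e := by
    refine Finset.sum_equiv finv_involutive.toPerm (fun e => ?_) fun e _ => ?_
    · simp [fsrc_finv, ftgt_finv, and_comm]
    · exact (phase_finv V₀ θ e).symm
  simp only [floquet, Matrix.of_apply, star_sub, star_mul', star_sum]
  congr 1
  · simp only [apply_ite star, star_one, star_zero, eq_comm]
  · rw [RCLike.star_def, Complex.conj_ofReal, mul_comm (G.deg v : ℝ)]
    exact congrArg _ hphases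

theorem floquet_mulVec [NeZero d] (Y : G.FundVertex → ℂ) (u : G.FundVertex) :
    (floquet V₀ θ).mulVec (fun v => √(G.deg v) * Y v) u =
      √(G.deg u) * Y u - hop V₀ θ Y u / √(G.deg u) := by
  have hsummand (v : G.FundVertex) : ((1 / √(G.deg u * G.deg v) : ℝ) : ℂ) *
      (∑ e with G.fsrc e = u ∧ G.ftgt e = v, phase V₀ θ e) * (√(G.deg v) * Y v) =
      (∑ e with G.fsrc e = u ∧ G.ftgt e = v, phase V₀ θ e * Y (G.ftgt e)) / √(G.deg u) := by
    have hfiber : ∑ e with G.fsrc e = u ∧ G.ftgt e = v, phase V₀ θ e * Y (G.ftgt e) =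
        (∑ e with G.fsrc e = u ∧ G.ftgt e = v, phase V₀ θ e) * Y v := by
      rw [Finset.sum_mul]
      exact Finset.sum_congr rfl fun e he => by rw [(Finset.mem_filter.mp he).2.2]
    have hu := sqrt_deg_ne_zero u
    have hv := sqrt_deg_ne_zero v
    rw [hfiber, Real.sqrt_mul (Nat.cast_nonneg _)]
    push_cast
    field_simp
  have hhop : ∑ v, ∑ e with G.fsrc e = u ∧ G.ftgt e = v, phase V₀ θ e * Y (G.ftgt e) =
      hop V₀ θ Y u := by
    rw [hop_apply, ← Finset.sum_fiberwise (s := Finset.univ.filter _) (g := G.ftgt)]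
    simp only [Finset.filter_filter]
  simp only [Matrix.mulVec, dotProduct, floquet, Matrix.of_apply, sub_mul, Finset.sum_sub_distrib,
    ite_mul, one_mul, zero_mul, Finset.sum_ite_eq, Finset.mem_univ, if_true]
  rw [← hhop, Finset.sum_div]
  exact congrArg _ (Finset.sum_congr rfl fun v _ => hsummand v)

theorem finrank_hopEigenspace [NeZero d] (κ : ℝ) :
    Module.finrank ℂ (hopEigenspace V₀ θ κ) = (eigs V₀ θ).count (1 - κ) := by
  let T : (G.FundVertex → ℂ) ≃ₗ[ℂ] EuclideanSpace ℂ G.FundVertex :=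
    (LinearEquiv.piCongrRight fun v =>
      LinearEquiv.smulOfUnit (Units.mk0 (√(G.deg v) : ℂ) (sqrt_deg_ne_zero v))) ≪≫ₗ
      (WithLp.linearEquiv 2 ℂ (G.FundVertex → ℂ)).symm
  have hT (Y : G.FundVertex → ℂ) : T Y = WithLp.toLp 2 fun v => (√(G.deg v) : ℂ) * Y v := rfl
  have hcomap : (Module.End.eigenspace (Matrix.toEuclideanLin (floquet V₀ θ))
      ((1 - κ : ℝ) : ℂ)).comap (T : _ →ₗ[ℂ] _) = hopEigenspace V₀ θ κ := by
    ext Y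
    rw [Submodule.mem_comap, Module.End.mem_eigenspace_iff, LinearEquiv.coe_coe, hT,
      Matrix.toLpLin_toLp, ← WithLp.toLp_smul, (WithLp.toLp_injective 2).eq_iff, funext_iff,
      mem_hopEigenspace_iff]
    refine forall_congr' fun v => ?_
    have hv := sqrt_deg_ne_zero v
    rw [Matrix.toLin'_apply, floquet_mulVec, Pi.smul_apply, smul_eq_mul, ← sqrt_deg_sq v]
    push_cast
    field_simp
    grind
  have hcount := finrank_eigenspace_toEuclideanLin (floquet_isHermitian V₀ θ) (1 - κ)
  rw [RCLike.re_eq_complex_re] at hcount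
  rw [eigs, ← hcount, ← hcomap, Submodule.comap_equiv_eq_map_symm]
  exact LinearEquiv.finrank_map_eq T.symm _

end Hopping

section Energy

/-- The contribution of an oriented edge of the fundamental graph to the energy. -/
noncomputable def edgeEnergy (V₀ : G.FundamentalVertexSet) (θ : EuclideanSpace ℝ (Fin d))
    (Y : G.FundVertex → ℂ) (e : G.FundEdge) : ℝ :=
  ‖Y (G.fsrc e) - phase V₀ θ e * Y (G.ftgt e)‖ ^ 2

/-- The Dirichlet form of the Laplacian with quasimomentum `θ`, relative to the weights `deg`.
Each unoriented edge is counted twice. -/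
noncomputable def energy (V₀ : G.FundamentalVertexSet) (θ : EuclideanSpace ℝ (Fin d))
    (Y : G.FundVertex → ℂ) : ℝ :=
  ∑ e, edgeEnergy V₀ θ Y e

variable {V₀ : G.FundamentalVertexSet} {θ : EuclideanSpace ℝ (Fin d)}

theorem edgeEnergy_nonneg (Y : G.FundVertex → ℂ) (e : G.FundEdge) : 0 ≤ edgeEnergy V₀ θ Y e :=
  sq_nonneg _

theorem energy_nonneg (Y : G.FundVertex → ℂ) : 0 ≤ energy V₀ θ Y :=
  Finset.sum_nonneg fun e _ => edgeEnergy_nonneg Y e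

theorem sum_star_mul_hop (V₀ : G.FundamentalVertexSet) (θ : EuclideanSpace ℝ (Fin d))
    (Y : G.FundVertex → ℂ) :
    ∑ v, star (Y v) * hop V₀ θ Y v =
      ∑ e, star (Y (G.fsrc e)) * (phase V₀ θ e * Y (G.ftgt e)) := by
  rw [← Finset.sum_fiberwise (s := Finset.univ) (g := G.fsrc)]
  refine Finset.sum_congr rfl fun v _ => ?_
  rw [hop_apply, Finset.mul_sum]
  exact Finset.sum_congr rfl fun e he => by rw [(Finset.mem_filter.mp he).2]

theorem sum_norm_sub_sq (V₀ : G.FundamentalVertexSet) (θ : EuclideanSpace ℝ (Fin d))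
    (Y : G.FundVertex → ℂ) {σ : ℝ} (hσ : σ ^ 2 = 1) :
    ∑ e, ‖Y (G.fsrc e) - σ * (phase V₀ θ e * Y (G.ftgt e))‖ ^ 2 =
      2 * ∑ v, G.deg v * ‖Y v‖ ^ 2 - 2 * σ * (∑ v, star (Y v) * hop V₀ θ Y v).re := by
  have hedge (e : G.FundEdge) : ‖Y (G.fsrc e) - σ * (phase V₀ θ e * Y (G.ftgt e))‖ ^ 2 =
      ‖Y (G.fsrc e)‖ ^ 2 + ‖Y (G.fsrc (G.finv e))‖ ^ 2 -
        2 * σ * (star (Y (G.fsrc e)) * (phase V₀ θ e * Y (G.ftgt e))).re := by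
    rw [@norm_sub_sq ℂ, norm_mul, norm_mul, norm_phase, one_mul, mul_pow, fsrc_finv,
      Complex.norm_real, Real.norm_eq_abs, sq_abs, hσ, one_mul, RCLike.inner_apply,
      RCLike.re_eq_complex_re, RCLike.star_def, mul_comm _ (starRingEnd ℂ (Y (G.fsrc e))),
      mul_left_comm, Complex.re_ofReal_mul]
    ring
  rw [Finset.sum_congr rfl fun e _ => hedge e, Finset.sum_sub_distrib, Finset.sum_add_distrib,
    sum_finv fun e => ‖Y (G.fsrc e)‖ ^ 2, ← Finset.mul_sum, ← Complex.re_sum,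
    sum_deg_mul fun v => ‖Y v‖ ^ 2, ← two_mul, sum_star_mul_hop]

theorem energy_eq (V₀ : G.FundamentalVertexSet) (θ : EuclideanSpace ℝ (Fin d))
    (Y : G.FundVertex → ℂ) :
    energy V₀ θ Y =
      2 * (∑ v, G.deg v * ‖Y v‖ ^ 2 - (∑ v, star (Y v) * hop V₀ θ Y v).re) := by
  have hsum := sum_norm_sub_sq V₀ θ Y (one_pow 2)
  simp only [Complex.ofReal_one, one_mul, mul_one] at hsum
  simp only [energy, edgeEnergy]
  rw [hsum, mul_sub]

theorem re_sum_star_mul_hop {κ : ℝ} {Y : G.FundVertex → ℂ} (hY : Y ∈ hopEigenspace V₀ θ κ) :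
    (∑ v, star (Y v) * hop V₀ θ Y v).re = κ * ∑ v, G.deg v * ‖Y v‖ ^ 2 := by
  rw [Complex.re_sum, Finset.mul_sum]
  refine Finset.sum_congr rfl fun v _ => ?_
  rw [mem_hopEigenspace_iff.mp hY, mul_left_comm, RCLike.star_def, Complex.conj_mul']
  norm_cast
  ring

theorem energy_of_mem_hopEigenspace {κ : ℝ} {Y : G.FundVertex → ℂ}
    (hY : Y ∈ hopEigenspace V₀ θ κ) :
    energy V₀ θ Y = 2 * (1 - κ) * ∑ v, G.deg v * ‖Y v‖ ^ 2 := by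
  rw [energy_eq, re_sum_star_mul_hop hY]
  ring

theorem sum_deg_norm_sq_pos [NeZero d] {Y : G.FundVertex → ℂ} (hY : Y ≠ 0) :
    0 < ∑ v, G.deg v * ‖Y v‖ ^ 2 := by
  obtain ⟨v, hv⟩ := Function.ne_iff.mp hY
  have hdeg := deg_pos v
  exact Finset.sum_pos' (fun u _ => by positivity)
    ⟨v, Finset.mem_univ _, mul_pos (mod_cast hdeg) (pow_pos (norm_pos_iff.mpr hv) 2)⟩

theorem exists_mem_hopEigenspace [NeZero d] {x : ℝ} (hx : x ∈ eigs V₀ θ) :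
    ∃ Y ∈ hopEigenspace V₀ θ (1 - x), Y ≠ 0 := by
  refine Submodule.exists_mem_ne_zero_of_ne_bot fun hbot => ?_
  have hrank := finrank_hopEigenspace V₀ θ (1 - x)
  rw [sub_sub_cancel, hbot, finrank_bot] at hrank
  exact (Multiset.count_pos.mpr hx).ne hrank

theorem eigs_mem_Icc [NeZero d] {x : ℝ} (hx : x ∈ eigs V₀ θ) : x ∈ Set.Icc (0 : ℝ) 2 := by
  obtain ⟨Y, hY, hY0⟩ := exists_mem_hopEigenspace hx
  have hpos := sum_deg_norm_sq_pos hY0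
  have hnonneg {σ : ℝ} (hσ : σ ^ 2 = 1) : 0 ≤ 1 - σ * (1 - x) := by
    have hsum := sum_norm_sub_sq V₀ θ Y hσ
    rw [re_sum_star_mul_hop hY] at hsum
    refine nonneg_of_mul_nonneg_left (b := 2 * ∑ v, G.deg v * ‖Y v‖ ^ 2) ?_ (by positivity)
    calc 0 ≤ ∑ e, ‖Y (G.fsrc e) - σ * (phase V₀ θ e * Y (G.ftgt e))‖ ^ 2 := by positivity
      _ = (1 - σ * (1 - x)) * (2 * ∑ v, G.deg v * ‖Y v‖ ^ 2) := by rw [hsum]; ring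
  constructor
  · linarith [hnonneg (one_pow 2)]
  · linarith [hnonneg neg_one_sq]

theorem re_dotProduct_floquet_mulVec [NeZero d] (V₀ : G.FundamentalVertexSet)
    (θ : EuclideanSpace ℝ (Fin d)) (Y : G.FundVertex → ℂ) :
    (star (fun v => √(G.deg v) * Y v) ⬝ᵥ
      (floquet V₀ θ).mulVec (fun v => √(G.deg v) * Y v)).re = energy V₀ θ Y / 2 := by
  have hsummand (v : G.FundVertex) :
      star (√(G.deg v) * Y v) * (floquet V₀ θ).mulVec (fun v => √(G.deg v) * Y v) v =
      ((G.deg v * ‖Y v‖ ^ 2 : ℝ) : ℂ) - star (Y v) * hop V₀ θ Y v := by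
    have hv := sqrt_deg_ne_zero v
    rw [floquet_mulVec, star_mul', RCLike.star_def, Complex.conj_ofReal]
    push_cast
    rw [← sqrt_deg_sq, ← Complex.conj_mul']
    field_simp
  simp only [dotProduct, Pi.star_apply, hsummand]
  rw [Finset.sum_sub_distrib, Complex.sub_re, ← Complex.ofReal_sum, Complex.ofReal_re, energy_eq]
  ring

theorem mul_sum_deg_norm_sq_le_energy [NeZero d] {m : ℝ} (hm : ∀ x ∈ eigs V₀ θ, m ≤ x)
    (Y : G.FundVertex → ℂ) : 2 * m * ∑ v, G.deg v * ‖Y v‖ ^ 2 ≤ energy V₀ θ Y := by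
  have hA := floquet_isHermitian V₀ θ
  have hrayleigh := mul_sum_norm_sq_le_re_dotProduct_mulVec hA
    (fun x hx => hm x ((mem_map_re_roots_charpoly_iff hA).mpr hx)) fun v => √(G.deg v) * Y v
  rw [RCLike.re_eq_complex_re, re_dotProduct_floquet_mulVec] at hrayleigh
  simp only [norm_mul, mul_pow, Complex.norm_real, Real.norm_eq_abs, sq_abs,
    Real.sq_sqrt (Nat.cast_nonneg _)] at hrayleigh
  linarith

theorem mul_totalDeg_le_sum_one_sub_cos [NeZero d] {m : ℝ} (hm : ∀ x ∈ eigs V₀ θ, m ≤ x) :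
    m * G.totalDeg ≤ ∑ e, (1 - Real.cos (pairing V₀ e θ)) := by
  have henergy : energy V₀ θ 1 = 2 * ∑ e, (1 - Real.cos (pairing V₀ e θ)) := by
    simp only [energy, edgeEnergy]
    rw [Finset.mul_sum]
    refine Finset.sum_congr rfl fun e _ => ?_
    rw [Pi.one_apply, Pi.one_apply, mul_one, @norm_sub_sq ℂ, norm_phase, phase,
      mul_comm Complex.I, norm_one, RCLike.inner_apply, map_one, mul_one, RCLike.re_eq_complex_re,
      Complex.exp_ofReal_mul_I_re]
    ring
  have hle := mul_sum_deg_norm_sq_le_energy hm 1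
  simp only [henergy, Pi.one_apply, norm_one, one_pow, mul_one] at hle
  rw [totalDeg, Nat.cast_sum]
  linarith

end Energy

section Bands

variable (V₀ : G.FundamentalVertexSet) (θ : EuclideanSpace ℝ (Fin d))

theorem card_eigs : (eigs V₀ θ).card = G.nu := by
  rw [eigs, (floquet_isHermitian V₀ θ).roots_charpoly_eq_eigenvalues, Multiset.card_map,
    Multiset.card_map]
  rfl

theorem count_flatBands (x : ℝ) : (flatBands V₀).count x = ⨅ θ, (eigs V₀ θ).count x := by
  rw [flatBands, Multiset.count_sum']
  simp only [Multiset.count_replicate, Finset.sum_ite_eq' (eigs V₀ 0).toFinset x]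
  split_ifs with hx
  · rfl
  · rw [Multiset.mem_toFinset, ← Multiset.count_eq_zero] at hx
    exact (Nat.eq_zero_of_le_zero (hx ▸ ciInf_le (OrderBot.bddBelow _) 0)).symm

theorem flatBands_le : flatBands V₀ ≤ eigs V₀ θ :=
  Multiset.le_iff_count.mpr fun x =>
    (count_flatBands V₀ x).trans_le (ciInf_le (OrderBot.bddBelow _) θ)

/-- The list of the values at `θ` of all band functions. -/
noncomputable def bandList : List ℝ :=
  (eigs V₀ θ - flatBands V₀).sort (· ≤ ·) ++ (flatBands V₀).sort (· ≤ ·)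

theorem band_eq_getD (n : ℕ) : band V₀ n θ = (bandList V₀ θ).getD (n - 1) 0 := rfl

theorem coe_bandList : (bandList V₀ θ : Multiset ℝ) = eigs V₀ θ := by
  rw [bandList, ← Multiset.coe_add, Multiset.sort_eq, Multiset.sort_eq,
    tsub_add_cancel_of_le (flatBands_le V₀ θ)]

theorem length_bandList : (bandList V₀ θ).length = G.nu := by
  rw [← Multiset.coe_card, coe_bandList, card_eigs]

theorem band_mem_eigs {n : ℕ} (hn : n ≤ G.nu) : band V₀ n θ ∈ eigs V₀ θ := by
  have hlt : n - 1 < (bandList V₀ θ).length := by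
    rw [length_bandList]
    have := G.nu_pos
    lia
  rw [← coe_bandList, Multiset.mem_coe, band_eq_getD, List.getD_eq_getElem _ _ hlt]
  exact List.getElem_mem hlt

theorem band_mem_Icc [NeZero d] (n : ℕ) : band V₀ n θ ∈ Set.Icc (0 : ℝ) 2 := by
  by_cases hn : n ≤ G.nu
  · exact eigs_mem_Icc (band_mem_eigs V₀ θ hn)
  · rw [band_eq_getD, List.getD_eq_default _ _ (by rw [length_bandList]; lia)]
    exact ⟨le_rfl, zero_le_two⟩

theorem card_eigs_sub : (eigs V₀ θ - flatBands V₀).card = G.nu - numFlat V₀ := by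
  rw [Multiset.card_sub (flatBands_le V₀ θ), card_eigs, numFlat]

theorem band_eq_getD_sort {n : ℕ} (hn : n - 1 < G.nu - numFlat V₀) :
    band V₀ n θ = ((eigs V₀ θ - flatBands V₀).sort (· ≤ ·)).getD (n - 1) 0 := by
  rw [band, List.getD_append]
  rwa [Multiset.length_sort, card_eigs_sub]

theorem prod_sub_eigs (t : ℝ) : ((eigs V₀ θ).map fun s => t - s).prod =
    ((t : ℂ) • (1 : Matrix G.FundVertex G.FundVertex ℂ) - floquet V₀ θ).det.re := by
  have hA := floquet_isHermitian V₀ θ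
  have hdet : ((t : ℂ) • (1 : Matrix G.FundVertex G.FundVertex ℂ) - floquet V₀ θ).det =
      ((∏ i, (t - hA.eigenvalues i) : ℝ) : ℂ) := by
    rw [Matrix.smul_one_eq_diagonal, ← Matrix.scalar_apply, ← Matrix.eval_charpoly,
      hA.charpoly_eq, Polynomial.eval_prod]
    simp
  rw [hdet, Complex.ofReal_re, eigs]
  exact congrArg (fun S : Multiset ℝ => (S.map fun s => t - s).prod)
    (map_re_roots_charpoly hA) |>.trans (by simp [Multiset.map_map])

theorem contDiff_phase (e : G.FundEdge) : ContDiff ℝ ⊤ fun θ => phase V₀ θ e := by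
  have hpairing : ContDiff ℝ ⊤ (pairing V₀ e) := by
    unfold pairing
    fun_prop
  exact (contDiff_const.mul (Complex.ofRealCLM.contDiff.comp hpairing)).cexp

theorem contDiff_prod_sub_eigs : ContDiff ℝ ⊤ fun q : EuclideanSpace ℝ (Fin d) × ℝ =>
    ((eigs V₀ q.1).map fun s => q.2 - s).prod := by
  have hphase (e : G.FundEdge) : ContDiff ℝ ⊤ fun q : EuclideanSpace ℝ (Fin d) × ℝ =>
      Complex.exp (Complex.I * (pairing V₀ e q.1 : ℝ)) := (contDiff_phase V₀ e).comp contDiff_fst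
  simp only [prod_sub_eigs, Matrix.det_apply, Units.smul_def, zsmul_eq_mul]
  refine Complex.reCLM.contDiff.comp (ContDiff.sum fun σ _ =>
    contDiff_const.mul (contDiff_prod fun i _ => ?_))
  simp only [Matrix.sub_apply, Matrix.smul_apply, floquet, Matrix.of_apply, smul_eq_mul]
  refine ((Complex.ofRealCLM.contDiff.comp contDiff_snd).mul contDiff_const).sub ?_
  exact contDiff_const.sub (contDiff_const.mul (ContDiff.sum fun e _ => hphase e))

theorem continuous_band [NeZero d] {n : ℕ} (hn : n - 1 < G.nu - numFlat V₀) :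
    Continuous (band V₀ n) := by
  rw [funext (f := band V₀ n) fun θ => band_eq_getD_sort V₀ θ hn]
  refine continuous_getD_sort (card_eigs_sub V₀)
    (fun θ s hs => eigs_mem_Icc (Multiset.mem_of_le tsub_le_self hs))
    (flatBands V₀).finite_toSet (fun t ht => ?_) hn
  have hne : ((flatBands V₀).map fun s => t - s).prod ≠ 0 := by
    simpa [Multiset.prod_eq_zero_iff, sub_eq_zero] using ht
  have hquot (θ) : ((eigs V₀ θ - flatBands V₀).map fun s => t - s).prod =
      ((eigs V₀ θ).map fun s => t - s).prod / ((flatBands V₀).map fun s => t - s).prod := by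
    rw [eq_div_iff hne, ← Multiset.prod_add, ← Multiset.map_add,
      tsub_add_cancel_of_le (flatBands_le V₀ θ)]
  simp only [hquot]
  exact ((contDiff_prod_sub_eigs V₀).continuous.comp
    (continuous_id.prodMk continuous_const)).div_const _

variable {θ} in
theorem analyticAt_band [NeZero d] {n : ℕ} (hn : n - 1 < G.nu - numFlat V₀)
    (hsimple : (eigs V₀ θ).count (band V₀ n θ) = 1) : AnalyticAt ℝ (band V₀ n) θ := by
  obtain ⟨c, hc, hderiv⟩ := exists_hasDerivAt_prod_sub_of_count_eq_one hsimple
  refine analyticAt_of_implicit (continuous_band V₀ hn).continuousAt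
    (contDiff_prod_sub_eigs V₀).contDiffAt (fun θ => ?_) hc hderiv
  exact Multiset.prod_eq_zero
    (Multiset.mem_map.mpr ⟨_, band_mem_eigs V₀ θ (by lia), sub_self _⟩)

end Bands

/-! ### The spectrum of the metric Laplacian -/

section MetricEigenspace

open MeasureTheory IsFundamentalSystem

variable (V₀ : G.FundamentalVertexSet) (O : G.Orientation) (θ : EuclideanSpace ℝ (Fin d))
  {E : ℝ} {c s : ℝ → ℝ}

open Classical in
theorem kirchhoff_eq {κ : ℝ} {σ : ℂ} (Y : G.FundVertex → ℂ) {p : O.carrier → ℝ → ℂ}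
    (hp₀ : ∀ e, p e 0 = σ * (phase V₀ θ e * Y (G.ftgt e) - κ * Y (G.fsrc e)))
    (hp₁ : ∀ e, p e 1 = σ * (κ * (phase V₀ θ e * Y (G.ftgt e)) - Y (G.fsrc e)))
    (v : G.FundVertex) :
    (∑ e : O.carrier, if G.fsrc e = v then p e 0 else 0) -
        (∑ e : O.carrier, if G.ftgt e = v then
          Complex.exp (-(Complex.I * (pairing V₀ e θ : ℝ))) * p e 1 else 0) =
      σ * (hop V₀ θ Y v - κ * G.deg v * Y v) := by
  have hdeg : ∑ e with G.fsrc e = v, Y (G.fsrc e) = G.deg v * Y v := by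
    rw [Finset.sum_congr rfl (g := fun _ => Y v)
      (fun e he => by rw [(Finset.mem_filter.mp he).2]), Finset.sum_const, nsmul_eq_mul, deg]
  have hhop : hop V₀ θ Y v - κ * G.deg v * Y v = ∑ e,
      if G.fsrc e = v then phase V₀ θ e * Y (G.ftgt e) - κ * Y (G.fsrc e) else 0 := by
    rw [← Finset.sum_filter, Finset.sum_sub_distrib, ← Finset.mul_sum, hdeg, hop_apply, mul_assoc]
  rw [hhop, sum_eq_sum_orientation O, Finset.mul_sum, ← Finset.sum_sub_distrib]
  refine Finset.sum_congr rfl fun e _ => ?_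
  have hphase := phase_finv_mul V₀ θ (e : G.FundEdge)
  rw [fsrc_finv, ftgt_finv, ← phase_finv_eq_exp_neg, hp₀, hp₁]
  split_ifs
  · linear_combination (-(σ * κ * Y (G.ftgt e))) * hphase
  · ring
  · linear_combination (-(σ * κ * Y (G.ftgt e))) * hphase
  · ring

theorem integral_smul_L2 (E : ℂ) {y : Lp ℂ 2 (volume.restrict (Set.Icc (0 : ℝ) 1))}
    {f : ℝ → ℂ} (hf : y =ᵐ[volume.restrict (Set.Icc (0 : ℝ) 1)] f) {t : ℝ}
    (ht : t ∈ Set.Icc (0 : ℝ) 1) :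
    ∫ x in (0 : ℝ)..t, (E • y) x = ∫ x in (0 : ℝ)..t, E * f x :=
  integral_L2_congr ((Lp.coeFn_smul E y).trans (hf.const_smul E)) ht

/-- The functions on the edges with given values at the vertices that solve `-f'' = E f`. -/
noncomputable def metricExtension (h : IsFundamentalSystem E c s) :
    (G.FundVertex → ℂ) →ₗ[ℂ] G.MetricL2 O where
  toFun Y e :=
    Y (G.fsrc e) • (memLp_restrict_Icc_of_continuous
      (Complex.continuous_ofReal.comp h.continuous_c) 0 1 2).toLp _ +
    initialSlope c s (Y (G.fsrc e)) (phase V₀ θ e * Y (G.ftgt e)) •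
      (memLp_restrict_Icc_of_continuous
        (Complex.continuous_ofReal.comp h.continuous_s) 0 1 2).toLp _
  map_add' Y Z := by
    funext e
    simp only [Pi.add_apply, initialSlope]
    module
  map_smul' r Y := by
    funext e
    simp only [Pi.smul_apply, RingHom.id_apply, smul_eq_mul, initialSlope]
    module

theorem metricExtension_ae_eq (h : IsFundamentalSystem E c s) (Y : G.FundVertex → ℂ)
    (e : O.carrier) :
    metricExtension V₀ O θ h Y e =ᵐ[volume.restrict (Set.Icc (0 : ℝ) 1)] fun t =>
      Y (G.fsrc e) * c t + initialSlope c s (Y (G.fsrc e)) (phase V₀ θ e * Y (G.ftgt e)) * s t :=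
  (Lp.coeFn_add _ _).trans (EventuallyEq.add
    ((Lp.coeFn_smul _ _).trans ((MemLp.coeFn_toLp _).const_smul _))
    ((Lp.coeFn_smul _ _).trans ((MemLp.coeFn_toLp _).const_smul _)))

variable {V₀ O θ}

theorem metricExtension_mem_metricEigenspace (h : IsFundamentalSystem E c s)
    {Y : G.FundVertex → ℂ} (hY : Y ∈ hopEigenspace V₀ θ (c 1)) :
    metricExtension V₀ O θ h Y ∈ metricEigenspace V₀ O θ E := by
  let b : O.carrier → ℂ := fun e =>
    initialSlope c s (Y (G.fsrc e)) (phase V₀ θ e * Y (G.ftgt e))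
  let p : O.carrier → ℝ → ℂ := fun e t => Y (G.fsrc e) * (-(E * s t)) + b e * c t
  have hp₀ (e : O.carrier) : p e 0 = b e := by simp [p, h.c_zero, h.s_zero]
  refine ⟨fun e t => Y (G.fsrc e) * c t + b e * s t, p, metricExtension_ae_eq V₀ O θ h Y,
    fun e t _ => (h.hasDerivAt_combination _ _ t).hasDerivWithinAt, fun e t ht => ?_,
    ⟨Y, fun e => ⟨?_, h.combination_one_eq_iff.mpr rfl⟩⟩, fun v => ?_⟩
  · have hint := (integral_smul_L2 E (metricExtension_ae_eq V₀ O θ h Y e) ht).trans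
      (h.integral_combination (Y (G.fsrc e)) (b e) t)
    refine Eq.trans ?_ (congrArg₂ (· - ·) (hp₀ e).symm hint.symm)
    rw [sub_sub_cancel]
  · simp [h.c_zero, h.s_zero]
  · rw [kirchhoff_eq V₀ O θ Y hp₀ (fun e => h.deriv_combination_one _ _) v,
      mem_hopEigenspace_iff.mp hY, sub_self, mul_zero]

theorem exists_metricExtension_eq (h : IsFundamentalSystem E c s) {y : G.MetricL2 O}
    (hy : y ∈ metricEigenspace V₀ O θ E) :
    ∃ Y ∈ hopEigenspace V₀ θ (c 1), metricExtension V₀ O θ h Y = y := by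
  obtain ⟨f, p, hyf, hf, hp, ⟨Y, hY⟩, hkirchhoff⟩ := hy
  have hsol (e : O.carrier) (t : ℝ) (ht : t ∈ Set.Icc (0 : ℝ) 1) := h.eq_combination (hf e)
    (fun t ht => by rw [← integral_smul_L2 E (hyf e) ht]; exact hp e t ht) ht
  have hone : (1 : ℝ) ∈ Set.Icc (0 : ℝ) 1 := Set.right_mem_Icc.mpr zero_le_one
  have hp₀ (e : O.carrier) :
      p e 0 = initialSlope c s (Y (G.fsrc e)) (phase V₀ θ e * Y (G.ftgt e)) := by
    rw [← h.combination_one_eq_iff, ← (hY e).1, ← (hsol e 1 hone).1]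
    exact (hY e).2
  have hp₁ (e : O.carrier) :
      p e 1 = (s 1 : ℂ)⁻¹ * (c 1 * (phase V₀ θ e * Y (G.ftgt e)) - Y (G.fsrc e)) := by
    rw [(hsol e 1 hone).2, (hY e).1, hp₀, h.deriv_combination_one]
  refine ⟨Y, mem_hopEigenspace_iff.mpr fun v => ?_, funext fun e => Lp.ext ?_⟩
  · have hzero := (kirchhoff_eq V₀ O θ Y hp₀ hp₁ v).symm.trans (hkirchhoff v)
    exact sub_eq_zero.mp ((mul_eq_zero.mp hzero).resolve_left
      (inv_ne_zero (Complex.ofReal_ne_zero.mpr h.s_one)))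
  · refine (metricExtension_ae_eq V₀ O θ h Y e).trans (EventuallyEq.trans ?_ (hyf e).symm)
    refine ae_restrict_of_forall_mem measurableSet_Icc fun t ht => ?_
    rw [(hsol e t ht).1, (hY e).1, hp₀]

theorem map_metricExtension (h : IsFundamentalSystem E c s) :
    (hopEigenspace V₀ θ (c 1)).map (metricExtension V₀ O θ h) = metricEigenspace V₀ O θ E :=
  le_antisymm (Submodule.map_le_iff_le_comap.mpr fun _ => metricExtension_mem_metricEigenspace h)
    fun _ => exists_metricExtension_eq h

theorem metricExtension_injective [NeZero d] (h : IsFundamentalSystem E c s) :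
    Function.Injective (metricExtension V₀ O θ h) := by
  refine (injective_iff_map_eq_zero _).mpr fun Y hY => ?_
  have hc := h.continuous_c
  have hs := h.continuous_s
  have hzero (e : O.carrier) : Y (G.fsrc e) = 0 ∧ Y (G.ftgt e) = 0 := by
    have hae := (metricExtension_ae_eq V₀ O θ h Y e).symm
    rw [hY] at hae
    have heq := Measure.eqOn_Icc_of_ae_eq volume zero_ne_one
      (hae.trans (Lp.coeFn_zero ℂ 2 _)) (Continuous.continuousOn (by fun_prop))
      (continuousOn_const (c := (0 : ℂ)))
    have hsrc : Y (G.fsrc e) = 0 := by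
      simpa [h.c_zero, h.s_zero] using heq (Set.left_mem_Icc.mpr zero_le_one)
    have htgt := heq (Set.right_mem_Icc.mpr zero_le_one)
    simp only [h.combination_one_eq_iff.mpr rfl, Pi.zero_apply] at htgt
    exact ⟨hsrc, (mul_eq_zero.mp htgt).resolve_left (Complex.exp_ne_zero _)⟩
  funext v
  obtain ⟨e, he⟩ := Finset.card_pos.mp (deg_pos v)
  rw [← (Finset.mem_filter.mp he).2]
  by_cases heO : e ∈ O.carrier
  · exact (hzero ⟨e, heO⟩).1
  · rw [← ftgt_finv]
    exact (hzero ⟨G.finv e, (mem_carrier_finv_iff O e).mpr heO⟩).2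

theorem finite_metricEigenspace (h : IsFundamentalSystem E c s) :
    Module.Finite ℂ (metricEigenspace V₀ O θ E) := by
  rw [← map_metricExtension h]
  infer_instance

theorem finrank_metricEigenspace [NeZero d] (h : IsFundamentalSystem E c s) :
    Module.finrank ℂ (metricEigenspace V₀ O θ E) = (eigs V₀ θ).count (1 - c 1) := by
  rw [← map_metricExtension h, ← finrank_hopEigenspace]
  exact (Submodule.equivMapOfInjective _ (metricExtension_injective h) _).finrank_eq.symm

end MetricEigenspace

section MetricSpectrum

variable (V₀ : G.FundamentalVertexSet) (O : G.Orientation) (θ : EuclideanSpace ℝ (Fin d))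

theorem metricZ_eq_foldedAngle (n j : ℕ) :
    metricZ V₀ n j θ = foldedAngle j (Real.arccos (1 - band V₀ n θ)) := rfl

theorem metricBand_eq_metricEnergy (n j : ℕ) :
    metricBand V₀ n j = fun θ => metricEnergy j (band V₀ n θ) := rfl

theorem metricZ_nonneg (n j : ℕ) : 0 ≤ metricZ V₀ n j θ :=
  foldedAngle_nonneg j (arccos_mem_Icc _)

theorem sqrt_metricBand (n j : ℕ) : Real.sqrt (metricBand V₀ n j θ) = metricZ V₀ n j θ :=
  Real.sqrt_sq (metricZ_nonneg V₀ θ n j)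

theorem cos_arccos_one_sub_band [NeZero d] (n : ℕ) :
    Real.cos (Real.arccos (1 - band V₀ n θ)) = 1 - band V₀ n θ := by
  obtain ⟨hnonneg, hle⟩ := band_mem_Icc V₀ θ n
  exact Real.cos_arccos (by linarith) (by linarith)

theorem cos_metricZ [NeZero d] (n j : ℕ) :
    Real.cos (metricZ V₀ n j θ) = 1 - band V₀ n θ := by
  rw [metricZ_eq_foldedAngle, cos_foldedAngle, cos_arccos_one_sub_band]

theorem card_band_eq (x : ℝ) :
    Nat.card {n : ℕ // 1 ≤ n ∧ n ≤ G.nu ∧ band V₀ n θ = x} = (eigs V₀ θ).count x := by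
  rw [← coe_bandList, Multiset.coe_count, ← card_getD_pred_eq_count _ 0, length_bandList]
  rfl

variable {z : ℝ}

theorem metricBand_eq_sq_iff [NeZero d] (n j : ℕ) (hz : 0 ≤ z)
    (hk : ∀ k : ℕ, z ≠ Real.pi * (k + 1)) :
    metricBand V₀ n j θ = z ^ 2 ↔ j = ⌊z / Real.pi⌋₊ ∧ band V₀ n θ = 1 - Real.cos z := by
  rw [metricBand, sq_eq_sq₀ (metricZ_nonneg V₀ θ n j) hz, metricZ_eq_foldedAngle,
    foldedAngle_eq_iff (arccos_mem_Icc _) hz hk, cos_arccos_one_sub_band]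
  refine and_congr_right fun _ => ?_
  constructor <;> intro h <;> linarith

theorem card_metricBand_eq_sq [NeZero d] (hz : 0 ≤ z) (hk : ∀ k : ℕ, z ≠ Real.pi * (k + 1)) :
    Nat.card {q : ℕ × ℕ // 1 ≤ q.1 ∧ q.1 ≤ G.nu ∧ metricBand V₀ q.1 q.2 θ = z ^ 2} =
      (eigs V₀ θ).count (1 - Real.cos z) := by
  have hiff (n j : ℕ) := metricBand_eq_sq_iff V₀ θ n j hz hk
  rw [← card_band_eq]
  exact Nat.card_congr
    { toFun := fun q => ⟨q.1.1, q.2.1, q.2.2.1, ((hiff _ _).mp q.2.2.2).2⟩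
      invFun := fun n => ⟨(n.1, ⌊z / Real.pi⌋₊), n.2.1, n.2.2.1, (hiff _ _).mpr ⟨rfl, n.2.2.2⟩⟩
      left_inv := fun q => Subtype.ext (Prod.ext rfl ((hiff _ _).mp q.2.2.2).1.symm)
      right_inv := fun n => rfl }

theorem exists_isFundamentalSystem_sq (hz : 0 ≤ z)
    (hk : ∀ k : ℤ, k ≠ 0 → z ^ 2 ≠ (Real.pi * k) ^ 2) :
    ∃ c s, IsFundamentalSystem (z ^ 2) c s ∧ c 1 = Real.cos z := by
  rcases hz.eq_or_lt with rfl | hpos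
  · rw [zero_pow two_ne_zero]
    exact ⟨_, _, isFundamentalSystem_zero, Real.cos_zero.symm⟩
  · exact ⟨_, _, isFundamentalSystem_of_pos hpos (sin_ne_zero_of_sq_ne hpos.ne' hk),
      by rw [mul_one]⟩

theorem finrank_metricEigenspace_sq [NeZero d] (hz : 0 ≤ z)
    (hk : ∀ k : ℤ, k ≠ 0 → z ^ 2 ≠ (Real.pi * k) ^ 2) :
    Module.finrank ℂ (metricEigenspace V₀ O θ (z ^ 2)) =
      (eigs V₀ θ).count (1 - Real.cos z) := by
  obtain ⟨c, s, hcs, hc⟩ := exists_isFundamentalSystem_sq hz hk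
  rw [finrank_metricEigenspace hcs, hc]

theorem finrank_metricEigenspace_neg_sq [NeZero d] (hz : 0 < z) :
    Module.finrank ℂ (metricEigenspace V₀ O θ (-z ^ 2)) = 0 := by
  rw [finrank_metricEigenspace (isFundamentalSystem_of_neg hz), Multiset.count_eq_zero, mul_one]
  intro hmem
  linarith [(eigs_mem_Icc hmem).1, Real.one_lt_cosh.mpr hz.ne']

variable {E : ℝ}

theorem finite_metricEigenspace_of_ne (hE : ∀ k : ℤ, k ≠ 0 → E ≠ (Real.pi * k) ^ 2) :
    Module.Finite ℂ (metricEigenspace V₀ O θ E) := by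
  rcases le_or_gt 0 E with hE_nonneg | hE_neg
  · rw [← Real.sq_sqrt hE_nonneg] at hE ⊢
    obtain ⟨c, s, hcs, -⟩ := exists_isFundamentalSystem_sq (Real.sqrt_nonneg E) hE
    exact finite_metricEigenspace hcs
  · rw [← neg_neg E, ← Real.sq_sqrt (neg_pos.mpr hE_neg).le]
    exact finite_metricEigenspace (isFundamentalSystem_of_neg (by simpa using hE_neg))

theorem finrank_metricEigenspace_eq_card [NeZero d]
    (hE : ∀ k : ℤ, k ≠ 0 → E ≠ (Real.pi * k) ^ 2) :
    Module.finrank ℂ (metricEigenspace V₀ O θ E) =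
      Nat.card {q : ℕ × ℕ // 1 ≤ q.1 ∧ q.1 ≤ G.nu ∧ metricBand V₀ q.1 q.2 θ = E} := by
  rcases le_or_gt 0 E with hE_nonneg | hE_neg
  · obtain ⟨z, hz, rfl⟩ : ∃ z : ℝ, 0 ≤ z ∧ z ^ 2 = E := ⟨√E, E.sqrt_nonneg, E.sq_sqrt hE_nonneg⟩
    rw [finrank_metricEigenspace_sq V₀ O θ hz hE, card_metricBand_eq_sq V₀ θ hz]
    rintro k rfl
    exact hE (k + 1) (by lia) (by push_cast; rfl)
  · have : IsEmpty {q : ℕ × ℕ // 1 ≤ q.1 ∧ q.1 ≤ G.nu ∧ metricBand V₀ q.1 q.2 θ = E} :=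
      ⟨fun q => hE_neg.not_ge (q.2.2.2 ▸ sq_nonneg _)⟩
    rw [Nat.card_of_isEmpty, ← neg_neg E, ← Real.sq_sqrt (neg_pos.mpr hE_neg).le,
      finrank_metricEigenspace_neg_sq V₀ O θ (by simpa using hE_neg)]

end MetricSpectrum

/-! ### Effective forms of the bands -/

section InteriorExtremum

variable {V₀ : G.FundamentalVertexSet} {O : G.Orientation} {θ₀ : EuclideanSpace ℝ (Fin d)}
  {n j : ℕ}

theorem sin_metricZ_ne_zero (hk : ∀ k : ℤ, metricBand V₀ n j θ₀ ≠ (Real.pi * k) ^ 2) :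
    Real.sin (metricZ V₀ n j θ₀) ≠ 0 := by
  refine sin_ne_zero_of_sq_ne (fun hz => hk 0 ?_) fun k _ => hk k
  rw [metricBand, hz, Int.cast_zero, mul_zero]

theorem band_mem_Ioo [NeZero d] (hk : ∀ k : ℤ, metricBand V₀ n j θ₀ ≠ (Real.pi * k) ^ 2) :
    band V₀ n θ₀ ∈ Set.Ioo 0 2 := by
  have hsin_sq := Real.sin_sq_add_cos_sq (metricZ V₀ n j θ₀)
  have hpos := pow_pos (abs_pos.mpr (sin_metricZ_ne_zero hk)) 2
  rw [cos_metricZ] at hsin_sq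
  rw [sq_abs] at hpos
  constructor <;> nlinarith

theorem count_eigs_band_eq_one [NeZero d]
    (hk : ∀ k : ℤ, metricBand V₀ n j θ₀ ≠ (Real.pi * k) ^ 2)
    (hs : IsSimpleMetricEigenvalue V₀ O θ₀ (metricBand V₀ n j θ₀)) :
    (eigs V₀ θ₀).count (band V₀ n θ₀) = 1 := by
  have hfinrank := finrank_metricEigenspace_sq V₀ O θ₀ (metricZ_nonneg V₀ θ₀ n j) fun k _ => hk k
  rw [cos_metricZ, sub_sub_cancel] at hfinrank
  exact hfinrank.symm.trans hs

theorem effectiveForm_metricBand [NeZero d] (hn : n - 1 < G.nu - numFlat V₀)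
    (hext : IsLocalExtr (metricBand V₀ n j) θ₀)
    (hk : ∀ k : ℤ, metricBand V₀ n j θ₀ ≠ (Real.pi * k) ^ 2)
    (hs : IsSimpleMetricEigenvalue V₀ O θ₀ (metricBand V₀ n j θ₀)) :
    HasEffectiveForm (band V₀ n) θ₀ ∧ HasEffectiveForm (metricBand V₀ n j) θ₀ ∧
      ∀ ω : EuclideanSpace ℝ (Fin d), ‖ω‖ = 1 →
        effectiveForm (metricBand V₀ n j) θ₀ ω =
          2 * √(metricBand V₀ n j θ₀) / Real.sin √(metricBand V₀ n j θ₀) *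
            effectiveForm (band V₀ n) θ₀ ω := by
  have hband := band_mem_Ioo hk
  have hsin := sin_metricZ_ne_zero hk
  have hz : metricZ V₀ n j θ₀ ≠ 0 := fun h => hsin (by rw [h, Real.sin_zero])
  have hanalytic : AnalyticAt ℝ (band V₀ n) θ₀ :=
    analyticAt_band V₀ hn (count_eigs_band_eq_one hk hs)
  have hanalytic_metric : AnalyticAt ℝ (metricBand V₀ n j) θ₀ := by
    rw [metricBand_eq_metricEnergy]
    exact (analyticAt_metricEnergy j hband).comp hanalytic
  have hderiv : HasDerivAt (metricEnergy j)
      (2 * metricZ V₀ n j θ₀ / Real.sin (metricZ V₀ n j θ₀)) (band V₀ n θ₀) :=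
    hasDerivAt_metricEnergy j hband
  have hcrit_metric : fderiv ℝ (metricBand V₀ n j) θ₀ = 0 := hext.fderiv_eq_zero
  have hcrit : fderiv ℝ (band V₀ n) θ₀ = 0 := by
    have hchain := (hderiv.comp_hasFDerivAt θ₀
      hanalytic.differentiableAt.hasFDerivAt).fderiv.symm.trans hcrit_metric
    exact (smul_eq_zero.mp hchain).resolve_left
      (div_ne_zero (mul_ne_zero two_ne_zero hz) hsin)
  have hform := hasEffectiveForm_of_analyticAt hanalytic hcrit
  have hform_metric := hasEffectiveForm_of_analyticAt hanalytic_metric hcrit_metric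
  refine ⟨hform, hform_metric, fun ω hω => ?_⟩
  rw [sqrt_metricBand]
  exact hform.effectiveForm_comp hform_metric hderiv hω

end InteriorExtremum

section Bloch

/-- The function on the periodic graph with quasimomentum `θ` and given values on the fundamental
vertex set. -/
noncomputable def bloch (V₀ : G.FundamentalVertexSet) (θ : EuclideanSpace ℝ (Fin d))
    (Y : G.FundVertex → ℂ) (x : V) : ℂ :=
  character θ (coord V₀ x) * Y (G.vclass x)

variable (V₀ : G.FundamentalVertexSet) (θ : EuclideanSpace ℝ (Fin d)) (Y : G.FundVertex → ℂ)

theorem norm_bloch (x : V) : ‖bloch V₀ θ Y x‖ = ‖Y (G.vclass x)‖ := by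
  rw [bloch, norm_mul, norm_character, one_mul]

theorem norm_bloch_vadd_sub (m : Fin d → ℤ) (x : V) :
    ‖bloch V₀ θ Y (m +ᵥ x) - bloch V₀ θ Y x‖ = ‖character θ m - 1‖ * ‖Y (G.vclass x)‖ := by
  have hvadd : bloch V₀ θ Y (m +ᵥ x) = character θ m * bloch V₀ θ Y x := by
    rw [bloch, bloch, coord_vadd, character_add, vclass_vadd, mul_assoc]
  rw [hvadd, ← norm_bloch V₀ θ Y x, ← norm_mul, sub_mul, one_mul]

theorem character_coord_src_mul_phase (a : A) :
    character θ (coord V₀ (G.src a)) * phase V₀ θ (G.eclass a) =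
      character θ (coord V₀ (G.tgt a)) := by
  rw [phase_eq_character, ← character_add, index_eclass, add_sub_cancel]

theorem norm_bloch_src_sub_tgt_sq (a : A) :
    ‖bloch V₀ θ Y (G.src a) - bloch V₀ θ Y (G.tgt a)‖ ^ 2 = edgeEnergy V₀ θ Y (G.eclass a) := by
  rw [edgeEnergy, bloch, bloch, ← character_coord_src_mul_phase, mul_assoc, ← mul_sub, norm_mul,
    norm_character, one_mul, fsrc_eclass, ftgt_eclass]

theorem norm_bloch_src_sub_tgt_le (a : A) :
    ‖bloch V₀ θ Y (G.src a) - bloch V₀ θ Y (G.tgt a)‖ ≤ √(energy V₀ θ Y) := by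
  refine Real.le_sqrt_of_sq_le ?_
  rw [norm_bloch_src_sub_tgt_sq]
  exact Finset.single_le_sum (fun e _ => edgeEnergy_nonneg Y e) (Finset.mem_univ (G.eclass a))

theorem exists_norm_bloch_sub_le (x y : V) :
    ∃ N : ℕ, ∀ θ Y, ‖bloch V₀ θ Y x - bloch V₀ θ Y y‖ ≤ N * √(energy V₀ θ Y) := by
  induction G.connected x y with
  | refl => exact ⟨0, fun θ Y => by simp⟩
  | tail _ hstep ih =>
    obtain ⟨N, hN⟩ := ih
    obtain ⟨a, rfl, rfl⟩ := hstep
    refine ⟨N + 1, fun θ Y => ?_⟩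
    rw [Nat.cast_add_one, add_one_mul]
    exact (norm_sub_le_norm_sub_add_norm_sub _ (bloch V₀ θ Y (G.src a)) _).trans
      (add_le_add (hN θ Y) (norm_bloch_src_sub_tgt_le V₀ θ Y a))

variable {V₀ θ Y} in
theorem bloch_eq_of_mem_hopEigenspace_one (hY : Y ∈ hopEigenspace V₀ θ 1) (x y : V) :
    bloch V₀ θ Y x = bloch V₀ θ Y y := by
  obtain ⟨N, hN⟩ := exists_norm_bloch_sub_le V₀ x y
  have hle := hN θ Y
  rw [energy_of_mem_hopEigenspace hY, sub_self, mul_zero, zero_mul, Real.sqrt_zero,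
    mul_zero] at hle
  exact sub_eq_zero.mp (norm_le_zero_iff.mp hle)

theorem exists_norm_le_norm_apply_add : ∃ C : ℕ, ∀ (θ : EuclideanSpace ℝ (Fin d))
    (Y : G.FundVertex → ℂ) (v : G.FundVertex), ‖Y‖ ≤ ‖Y v‖ + C * √(energy V₀ θ Y) := by
  choose rep hrep using G.vclass_surjective
  choose N hN using fun u v => exists_norm_bloch_sub_le V₀ (rep u) (rep v)
  obtain ⟨C, hC⟩ := Finite.exists_le fun p : G.FundVertex × G.FundVertex => N p.1 p.2
  refine ⟨C, fun θ Y v => (pi_norm_le_iff_of_nonneg (by positivity)).mpr fun u => ?_⟩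
  have hdiff : ‖Y u‖ - ‖Y v‖ ≤ ‖bloch V₀ θ Y (rep u) - bloch V₀ θ Y (rep v)‖ := by
    simpa only [norm_bloch, hrep] using
      norm_sub_norm_le (bloch V₀ θ Y (rep u)) (bloch V₀ θ Y (rep v))
  have hle : (N u v : ℝ) * √(energy V₀ θ Y) ≤ C * √(energy V₀ θ Y) := by
    gcongr
    exact hC (u, v)
  linarith [hN u v θ Y]

theorem sq_mul_sum_norm_character_sub_one_sq_le {ι : Type*} [Fintype ι] {m : ι → Fin d → ℤ}
    {x : ι → V} {K w l : ℝ} (hK : 0 ≤ K)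
    (hbloch : ∑ i, ‖bloch V₀ θ Y (m i +ᵥ x i) - bloch V₀ θ Y (x i)‖ ^ 2 ≤
      K * (energy V₀ θ Y / 2))
    (hw : 0 ≤ w) (hY : ∀ v, w ≤ ‖Y v‖) (hl : energy V₀ θ Y ≤ 2 * l) :
    w ^ 2 * ∑ i, ‖character θ (m i) - 1‖ ^ 2 ≤ K * l :=
  calc w ^ 2 * ∑ i, ‖character θ (m i) - 1‖ ^ 2
      = ∑ i, (‖character θ (m i) - 1‖ * w) ^ 2 := by
        rw [Finset.mul_sum]
        exact Finset.sum_congr rfl fun i _ => by ring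
    _ ≤ ∑ i, ‖bloch V₀ θ Y (m i +ᵥ x i) - bloch V₀ θ Y (x i)‖ ^ 2 := by
        simp only [norm_bloch_vadd_sub]
        gcongr with i
        exact hY _
    _ ≤ K * (energy V₀ θ Y / 2) := hbloch
    _ ≤ K * l := by
        gcongr
        linarith

theorem exists_almost_constant_eigenvector [NeZero d] :
    ∃ C : ℕ, ∀ θ, ∀ l ∈ eigs V₀ θ, ∃ Y : G.FundVertex → ℂ,
      (∀ v, 1 - C * √(2 * l * G.totalDeg) ≤ ‖Y v‖) ∧ energy V₀ θ Y ≤ 2 * l * G.totalDeg := by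
  obtain ⟨C, hC⟩ := exists_norm_le_norm_apply_add V₀
  refine ⟨C, fun θ l hl => ?_⟩
  have hl_nonneg := (eigs_mem_Icc hl).1
  obtain ⟨Z, hZ, hZ_ne⟩ := exists_mem_hopEigenspace hl
  obtain ⟨Y, hY, hY_norm⟩ : ∃ Y ∈ hopEigenspace V₀ θ (1 - l), ‖Y‖ = 1 :=
    ⟨_, Submodule.smul_mem _ _ hZ, norm_smul_inv_norm (𝕜 := ℂ) hZ_ne⟩
  have henergy : energy V₀ θ Y ≤ 2 * l * G.totalDeg := by
    rw [energy_of_mem_hopEigenspace hY, sub_sub_cancel, totalDeg, Nat.cast_sum]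
    gcongr with v
    refine mul_le_of_le_one_right (by positivity) (pow_le_one₀ (norm_nonneg _) ?_)
    exact hY_norm ▸ norm_le_pi_norm Y v
  refine ⟨Y, fun v => ?_, henergy⟩
  have hsqrt : (C : ℝ) * √(energy V₀ θ Y) ≤ C * √(2 * l * G.totalDeg) := by gcongr
  linarith [hY_norm ▸ hC θ Y v]

end Bloch

section LowestBand

variable (V₀ : G.FundamentalVertexSet) {ω : EuclideanSpace ℝ (Fin d)}

open Classical in
theorem sum_pairing_sq_eq (O : G.Orientation) :
    ∑ e, pairing V₀ e ω ^ 2 = 2 * ∑ e ∈ bridges V₀ O, pairing V₀ e ω ^ 2 := by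
  have hbridges : ∑ e : O.carrier, pairing V₀ e ω ^ 2 = ∑ e ∈ bridges V₀ O, pairing V₀ e ω ^ 2 := by
    rw [← Finset.sum_subtype (Finset.univ.filter (· ∈ O.carrier)) (by simp)
      fun e => pairing V₀ e ω ^ 2]
    refine (Finset.sum_subset (fun e he => ?_) fun e he he' => ?_).symm
    · simp_all [bridges]
    · have hindex : index V₀ e = 0 := by simp_all [bridges]
      simp [pairing, hindex]
  rw [sum_eq_sum_orientation O, ← hbridges, Finset.mul_sum]
  simp only [pairing_finv, neg_sq, two_mul]

variable [NeZero d]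

theorem count_zero_eigs_zero : (eigs V₀ 0).count 0 = 1 := by
  have hfinrank := finrank_hopEigenspace V₀ 0 1
  rw [sub_self] at hfinrank
  have hone : (1 : G.FundVertex → ℂ) ∈ hopEigenspace V₀ 0 1 :=
    mem_hopEigenspace_iff.mpr fun v => by simp [hop_apply, phase_zero, deg]
  obtain ⟨x⟩ := G.nonempty
  rw [← hfinrank]
  refine finrank_eq_one_iff'.mpr ⟨⟨1, hone⟩, fun hzero => ?_, fun Y => ⟨Y.1 (G.vclass x), ?_⟩⟩
  · exact one_ne_zero (congrFun (congrArg Subtype.val hzero) (G.vclass x))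
  · refine Subtype.ext (funext fun v => ?_)
    obtain ⟨y, rfl⟩ := vclass_surjective v
    have hconst := bloch_eq_of_mem_hopEigenspace_one Y.2 x y
    rw [bloch, bloch, character_zero, character_zero, one_mul, one_mul] at hconst
    simp [hconst]

theorem zero_notMem_flatBands : (0 : ℝ) ∉ flatBands V₀ := by
  intro hflat
  let θ : EuclideanSpace ℝ (Fin d) := EuclideanSpace.single 0 Real.pi
  have hcharacter : character θ (Pi.single 0 1) = -1 := by
    rw [character, latticePairing_single_one, ← Complex.exp_pi_mul_I]
    simp [θ]
  obtain ⟨Y, hY, hY_ne⟩ := exists_mem_hopEigenspace (Multiset.mem_of_le (flatBands_le V₀ θ) hflat)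
  rw [sub_zero] at hY
  refine hY_ne (funext fun v => ?_)
  obtain ⟨x, rfl⟩ := vclass_surjective v
  have hshift := norm_bloch_vadd_sub V₀ θ Y (Pi.single 0 1) x
  rw [bloch_eq_of_mem_hopEigenspace_one hY _ x, sub_self, norm_zero, hcharacter, eq_comm,
    mul_eq_zero] at hshift
  exact norm_eq_zero.mp (hshift.resolve_left (by norm_num))

theorem zero_mem_eigs_sub_flatBands : (0 : ℝ) ∈ eigs V₀ 0 - flatBands V₀ := by
  rw [← Multiset.one_le_count_iff_mem, Multiset.count_sub, count_zero_eigs_zero,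
    Multiset.count_eq_zero.mpr (zero_notMem_flatBands V₀)]

theorem nu_sub_numFlat_pos : 0 < G.nu - numFlat V₀ := by
  rw [← card_eigs_sub V₀ 0, Multiset.card_pos_iff_exists_mem]
  exact ⟨0, zero_mem_eigs_sub_flatBands V₀⟩

variable {V₀} in
theorem band_one_le_of_mem_sub {θ : EuclideanSpace ℝ (Fin d)} {x : ℝ}
    (hx : x ∈ eigs V₀ θ - flatBands V₀) : band V₀ 1 θ ≤ x := by
  rw [band_eq_getD_sort V₀ θ (nu_sub_numFlat_pos V₀)]
  exact getD_zero_le_of_mem (Multiset.pairwise_sort _ _) 0 ((Multiset.mem_sort _).mpr hx)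

theorem band_one_zero : band V₀ 1 0 = 0 :=
  le_antisymm (band_one_le_of_mem_sub (zero_mem_eigs_sub_flatBands V₀)) (band_mem_Icc V₀ 0 1).1

theorem tendsto_band_one : Tendsto (band V₀ 1) (𝓝 0) (𝓝 0) := by
  simpa only [band_one_zero] using (continuous_band V₀ (n := 1) (nu_sub_numFlat_pos V₀)).tendsto 0

theorem eventually_forall_band_one_le : ∀ᶠ θ in 𝓝 0, ∀ x ∈ eigs V₀ θ, band V₀ 1 θ ≤ x := by
  have hflat : ∀ᶠ θ in 𝓝 0, ∀ x ∈ (flatBands V₀).toFinset, band V₀ 1 θ < x := by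
    rw [eventually_all_finset]
    intro x hx
    rw [Multiset.mem_toFinset] at hx
    have hx_nonneg : 0 ≤ x := (eigs_mem_Icc (Multiset.mem_of_le (flatBands_le V₀ 0) hx)).1
    have hx_ne : (0 : ℝ) ≠ x := fun h => zero_notMem_flatBands V₀ (h ▸ hx)
    exact (tendsto_band_one V₀).eventually_lt_const (lt_of_le_of_ne hx_nonneg hx_ne)
  filter_upwards [hflat] with θ hθ x hx
  rw [← tsub_add_cancel_of_le (flatBands_le V₀ θ), Multiset.mem_add] at hx
  rcases hx with hx | hx
  · exact band_one_le_of_mem_sub hx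
  · exact (hθ x (Multiset.mem_toFinset.mpr hx)).le

theorem analyticAt_band_one : AnalyticAt ℝ (band V₀ 1) 0 :=
  analyticAt_band V₀ (nu_sub_numFlat_pos V₀) (by rw [band_one_zero, count_zero_eigs_zero])

theorem hasEffectiveForm_band_one : HasEffectiveForm (band V₀ 1) 0 := by
  refine hasEffectiveForm_of_analyticAt (analyticAt_band_one V₀)
    (IsLocalMin.fderiv_eq_zero (Eventually.of_forall fun θ => ?_))
  rw [band_one_zero]
  exact (band_mem_Icc V₀ θ 1).1

theorem metricBand_one_zero_zero : metricBand V₀ 1 0 0 = 0 := by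
  simp [metricBand, metricZ, band_one_zero]

theorem exists_metricBand_one_zero_eventuallyEq : ∃ h : ℝ → ℝ, AnalyticAt ℝ h 0 ∧
    HasDerivAt h 2 0 ∧ metricBand V₀ 1 0 =ᶠ[𝓝 0] fun θ => h (band V₀ 1 θ) := by
  obtain ⟨h, hh, hderiv, harccos⟩ := exists_analyticAt_arccos_sq
  refine ⟨h, hh, hderiv, ?_⟩
  filter_upwards [(tendsto_band_one V₀).eventually harccos] with θ hθ
  rw [← hθ (band_mem_Icc V₀ θ 1).1]
  simp [metricBand, metricZ]

theorem analyticAt_metricBand_one_zero : AnalyticAt ℝ (metricBand V₀ 1 0) 0 := by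
  obtain ⟨h, hh, -, heq⟩ := exists_metricBand_one_zero_eventuallyEq V₀
  rw [← band_one_zero V₀] at hh
  exact (hh.comp (analyticAt_band_one V₀)).congr heq.symm

theorem hasEffectiveForm_metricBand_one_zero : HasEffectiveForm (metricBand V₀ 1 0) 0 := by
  refine hasEffectiveForm_of_analyticAt (analyticAt_metricBand_one_zero V₀)
    (IsLocalMin.fderiv_eq_zero (Eventually.of_forall fun θ => ?_))
  rw [metricBand_one_zero_zero]
  exact sq_nonneg _

theorem effectiveForm_metricBand_one_zero (hω : ‖ω‖ = 1) :
    effectiveForm (metricBand V₀ 1 0) 0 ω = 2 * effectiveForm (band V₀ 1) 0 ω := by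
  obtain ⟨h, -, hderiv, heq⟩ := exists_metricBand_one_zero_eventuallyEq V₀
  rw [← band_one_zero V₀] at hderiv
  rw [effectiveForm_congr heq]
  exact (hasEffectiveForm_band_one V₀).effectiveForm_comp
    ((hasEffectiveForm_metricBand_one_zero V₀).congr heq.symm) hderiv hω

theorem effectiveForm_band_one_le (O : G.Orientation) (hω : ‖ω‖ = 1) :
    effectiveForm (band V₀ 1) 0 ω ≤
      1 / (G.totalDeg : ℝ) * ∑ e ∈ bridges V₀ O, pairing V₀ e ω ^ 2 := by
  have hdeg : (0 : ℝ) < G.totalDeg := mod_cast totalDeg_pos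
  refine le_of_tendsto ((hasEffectiveForm_band_one V₀).tendsto hω) ?_
  filter_upwards [(tendsto_add_smul_nhdsGT 0 ω).eventually (eventually_forall_band_one_le V₀),
    self_mem_nhdsWithin] with ε hε hε_mem
  have hε_pos : 0 < ε := hε_mem
  have htrial := mul_totalDeg_le_sum_one_sub_cos hε
  have hcos : ∑ e, (1 - Real.cos (pairing V₀ e (0 + ε • ω))) ≤
      ∑ e, ε ^ 2 / 2 * pairing V₀ e ω ^ 2 := by
    refine Finset.sum_le_sum fun e _ => ?_
    rw [zero_add, pairing_smul]
    linarith [Real.one_sub_sq_div_two_le_cos (x := ε * pairing V₀ e ω),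
      mul_pow ε (pairing V₀ e ω) 2]
  rw [← Finset.mul_sum, sum_pairing_sq_eq V₀ O] at hcos
  rw [band_one_zero, sub_zero, div_le_iff₀ (by positivity), one_div, inv_mul_eq_div,
    div_mul_eq_mul_div, le_div_iff₀ hdeg]
  linarith

theorem sum_latticePairing_sq_le_effectiveForm {ι : Type*} [Fintype ι] {m : ι → Fin d → ℤ}
    {x : ι → V} {K : ℝ} (hK : 0 ≤ K)
    (hbloch : ∀ θ Y, ∑ i, ‖bloch V₀ θ Y (m i +ᵥ x i) - bloch V₀ θ Y (x i)‖ ^ 2 ≤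
      K * (energy V₀ θ Y / 2)) (hω : ‖ω‖ = 1) :
    ∑ i, latticePairing (m i) ω ^ 2 ≤ K * (G.totalDeg * effectiveForm (band V₀ 1) 0 ω) := by
  obtain ⟨C, hC⟩ := exists_almost_constant_eigenvector V₀
  let w (l : ℝ) : ℝ := 1 - C * √(2 * l * G.totalDeg)
  have hw : Tendsto (fun ε : ℝ => w (band V₀ 1 (0 + ε • ω))) (𝓝[>] 0) (𝓝 1) := by
    have hcont : Continuous w := by fun_prop
    exact ((hcont.tendsto' 0 1 (by simp [w])).comp (tendsto_band_one V₀)).comp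
      (tendsto_add_smul_nhdsGT 0 ω)
  have hlower : Tendsto (fun ε : ℝ => w (band V₀ 1 (0 + ε • ω)) ^ 2 *
      ∑ i, ‖character (0 + ε • ω) (m i) - 1‖ ^ 2 / ε ^ 2) (𝓝[>] 0)
      (𝓝 (∑ i, latticePairing (m i) ω ^ 2)) := by
    simpa only [one_pow, one_mul] using
      (hw.pow 2).mul (tendsto_finsetSum _ fun i _ => tendsto_norm_character_sub_one ω (m i))
  have hupper := (((hasEffectiveForm_band_one V₀).tendsto hω).const_mul
    (G.totalDeg : ℝ)).const_mul K
  refine le_of_tendsto_of_tendsto hlower hupper ?_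
  filter_upwards [self_mem_nhdsWithin, hw.eventually_const_lt zero_lt_one] with ε hε hw_pos
  have hε_pos : 0 < ε := hε
  obtain ⟨Y, hY, henergy⟩ := hC (0 + ε • ω) _ (band_mem_eigs V₀ (0 + ε • ω) nu_pos)
  have hle := sq_mul_sum_norm_character_sub_one_sq_le V₀ _ Y hK (hbloch _ Y) hw_pos.le hY
    (henergy.trans_eq (mul_assoc _ _ _))
  rw [← Finset.sum_div, band_one_zero, sub_zero, ← mul_div_assoc, ← mul_div_assoc,
    ← mul_div_assoc, mul_comm (G.totalDeg : ℝ)]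
  gcongr

theorem effectiveForm_band_one_pos (hω : ‖ω‖ = 1) : 0 < effectiveForm (band V₀ 1) 0 ω := by
  obtain ⟨x⟩ := G.nonempty
  choose N hN using fun i : Fin d =>
    exists_norm_bloch_sub_le V₀ ((Pi.single i 1 : Fin d → ℤ) +ᵥ x) x
  have hbloch (θ : EuclideanSpace ℝ (Fin d)) (Y : G.FundVertex → ℂ) :
      ∑ i : Fin d, ‖bloch V₀ θ Y ((Pi.single i 1 : Fin d → ℤ) +ᵥ x) - bloch V₀ θ Y x‖ ^ 2 ≤
        (∑ i, 2 * (N i : ℝ) ^ 2) * (energy V₀ θ Y / 2) := by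
    rw [Finset.sum_mul]
    refine Finset.sum_le_sum fun i _ => ?_
    refine (pow_le_pow_left₀ (norm_nonneg _) (hN i θ Y) 2).trans_eq ?_
    rw [mul_pow, Real.sq_sqrt (energy_nonneg Y)]
    ring
  have hle := sum_latticePairing_sq_le_effectiveForm V₀
    (Finset.sum_nonneg fun _ _ => by positivity) hbloch hω
  simp only [latticePairing_single_one, ← EuclideanSpace.real_norm_sq_eq, hω] at hle
  have hpos := (zero_lt_one.trans_eq (one_pow 2).symm).trans_le hle
  exact pos_of_mul_pos_right (pos_of_mul_pos_right hpos (by positivity)) (by positivity)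

end LowestBand

/-! ### Bridges and trees -/

section Tree

variable {V₀ : G.FundamentalVertexSet}

theorem coord_eq_zero {x : V} (hx : x ∈ V₀.carrier) : coord V₀ x = 0 :=
  coord_eq V₀ hx (zero_vadd _ x)

theorem vclass_injOn (V₀ : G.FundamentalVertexSet) : Set.InjOn G.vclass V₀.carrier := by
  intro x hx y hy h
  obtain ⟨m, hm⟩ := vclass_eq_iff.mp h
  exact (V₀.existsUnique x).unique ⟨hx, 0, zero_vadd _ x⟩ ⟨hy, m, hm⟩

theorem exists_eclass_eq_src_mem (V₀ : G.FundamentalVertexSet) (e : G.FundEdge) :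
    ∃ a, G.eclass a = e ∧ G.src a ∈ V₀.carrier := by
  obtain ⟨a, rfl⟩ := eclass_surjective e
  obtain ⟨u, hu, hcoord⟩ := coord_spec V₀ (G.src a)
  refine ⟨-coord V₀ (G.src a) +ᵥ a, eclass_vadd _ _, ?_⟩
  rwa [G.src_vadd, neg_vadd_eq_iff.mpr hcoord.symm]

theorem exists_fundEdge_of_adj {x y : V} (hadj : G.toSimpleGraph.Adj x y) (hx : x ∈ V₀.carrier)
    (hy : y ∈ V₀.carrier) :
    ∃ e, G.fsrc e = G.vclass x ∧ G.ftgt e = G.vclass y ∧ index V₀ e = 0 ∧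
      ∀ θ Y, edgeEnergy V₀ θ Y e = ‖bloch V₀ θ Y x - bloch V₀ θ Y y‖ ^ 2 := by
  obtain ⟨-, a, rfl, rfl⟩ := hadj
  refine ⟨G.eclass a, rfl, rfl, ?_, fun θ Y => ?_⟩
  · rw [index_eclass, coord_eq_zero hx, coord_eq_zero hy, sub_zero]
  · rw [norm_bloch_src_sub_tgt_sq]

variable {θ : EuclideanSpace ℝ (Fin d)} {Y : G.FundVertex → ℂ}

theorem edgeEnergy_finv (e : G.FundEdge) :
    edgeEnergy V₀ θ Y (G.finv e) = edgeEnergy V₀ θ Y e := by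
  obtain ⟨a, rfl⟩ := eclass_surjective e
  rw [finv_eclass, ← norm_bloch_src_sub_tgt_sq, ← norm_bloch_src_sub_tgt_sq, G.src_inv, tgt_inv,
    norm_sub_rev]

theorem sum_edgeEnergy_le_half_energy {S : Finset G.FundEdge} (hS : ∀ e ∈ S, G.finv e ∉ S) :
    ∑ e ∈ S, edgeEnergy V₀ θ Y e ≤ energy V₀ θ Y / 2 := by
  have hdisjoint : Disjoint S (S.map finv_involutive.toPerm.toEmbedding) := by
    refine Finset.disjoint_left.mpr fun e he he_map => ?_
    obtain ⟨e', he', rfl⟩ := Finset.mem_map.mp he_map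
    exact hS e' he' he
  have hle : ∑ e ∈ S.disjUnion _ hdisjoint, edgeEnergy V₀ θ Y e ≤ energy V₀ θ Y :=
    Finset.sum_le_univ_sum_of_nonneg (edgeEnergy_nonneg Y)
  have hfinv : ∑ e ∈ S, edgeEnergy V₀ θ Y (G.finv e) = ∑ e ∈ S, edgeEnergy V₀ θ Y e :=
    Finset.sum_congr rfl fun e _ => edgeEnergy_finv e
  rw [Finset.sum_disjUnion, Finset.sum_map] at hle
  simp only [Equiv.coe_toEmbedding, Function.Involutive.coe_toPerm, hfinv] at hle
  linarith

variable {T : G.toSimpleGraph.Subgraph} (hT : T.verts ⊆ V₀.carrier) {u w : T.verts}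
  {p : T.coe.Walk u w}
include hT

theorem length_add_one_le_nu (hp : p.IsPath) : p.length + 1 ≤ G.nu := by
  have hnodup : (p.support.map fun x : T.verts => G.vclass x).Nodup :=
    hp.support_nodup.map fun x y h => Subtype.ext (vclass_injOn V₀ (hT x.2) (hT y.2) h)
  simpa [nu] using hnodup.length_le_card

theorem edgeEnergy_add_sum_darts_le (hp : p.IsTrail) {e : G.FundEdge} (he : index V₀ e ≠ 0) :
    edgeEnergy V₀ θ Y e +
      (p.darts.map fun a => ‖bloch V₀ θ Y a.fst - bloch V₀ θ Y a.snd‖ ^ 2).sum ≤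
        energy V₀ θ Y / 2 := by
  classical
  choose lift hsrc htgt hindex henergy using fun a : T.coe.Dart =>
    exists_fundEdge_of_adj (T.adj_sub a.adj) (hT a.fst.2) (hT a.snd.2)
  have hvclass {x y : T.verts} (h : G.vclass x = G.vclass y) : x = y :=
    Subtype.ext (vclass_injOn V₀ (hT x.2) (hT y.2) h)
  have hlift : Function.Injective lift := fun a b h => SimpleGraph.Dart.ext _ _ <| Prod.ext
    (hvclass (by rw [← hsrc, h, hsrc])) (hvclass (by rw [← htgt, h, htgt]))
  have hlift_ne {a b : T.coe.Dart} (ha : a ∈ p.darts) (hb : b ∈ p.darts) :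
      G.finv (lift a) ≠ lift b := by
    intro h
    have hsymm : b = a.symm := SimpleGraph.Dart.ext _ _ <| Prod.ext
      (hvclass (by rw [← hsrc, ← h, fsrc_finv, htgt]; rfl))
      (hvclass (by rw [← htgt, ← h, ftgt_finv, hsrc]; rfl))
    have hedge : a.edge = b.edge := by rw [hsymm, SimpleGraph.Dart.edge_symm]
    exact a.symm_ne ((List.inj_on_of_nodup_map hp.edges_nodup ha hb hedge).trans hsymm).symm
  have hlift_e (a : T.coe.Dart) : lift a ≠ e := fun h => he (h ▸ hindex a)
  have hdarts : (p.darts.map fun a => ‖bloch V₀ θ Y a.fst - bloch V₀ θ Y a.snd‖ ^ 2).sum =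
      ∑ e' ∈ p.darts.toFinset.image lift, edgeEnergy V₀ θ Y e' := by
    rw [Finset.sum_image hlift.injOn, List.sum_toFinset _ hp.edges_nodup.of_map]
    simp only [henergy]
  have he_notMem : e ∉ p.darts.toFinset.image lift := by
    simpa using fun a _ => hlift_e a
  rw [hdarts, ← Finset.sum_insert he_notMem]
  refine sum_edgeEnergy_le_half_energy fun e₁ he₁ he₂ => ?_
  have hindex_finv : index V₀ (G.finv e₁) = -index V₀ e₁ := index_finv V₀ e₁
  simp only [Finset.mem_insert, Finset.mem_image, List.mem_toFinset] at he₁ he₂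
  rcases he₁ with rfl | ⟨a, ha, rfl⟩ <;> rcases he₂ with he₂ | ⟨b, hb, he₂⟩
  · rw [he₂] at hindex_finv
    exact he (self_eq_neg.mp hindex_finv)
  · rw [← he₂, hindex, eq_comm, neg_eq_zero] at hindex_finv
    exact he hindex_finv
  · rw [he₂, hindex, neg_zero] at hindex_finv
    exact he hindex_finv
  · exact hlift_ne ha hb he₂.symm

omit hT in
/-- A bridge joins two points of the tree after a lattice shift of one of them, and together with
the path joining them it consists of at most `ν` edges, on which the energy is shared. -/
theorem norm_bloch_index_vadd_sub_sq_le (hV₀ : V₀.IsTree) {e : G.FundEdge} (he : index V₀ e ≠ 0) :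
    ∃ x : V, ∀ (θ : EuclideanSpace ℝ (Fin d)) (Y : G.FundVertex → ℂ),
      ‖bloch V₀ θ Y (index V₀ e +ᵥ x) - bloch V₀ θ Y x‖ ^ 2 ≤ G.nu * (energy V₀ θ Y / 2) := by
  obtain ⟨T, hT, hT_tree⟩ := hV₀
  obtain ⟨a, rfl, hsrc⟩ := exists_eclass_eq_src_mem V₀ e
  obtain ⟨x, hx, hcoord⟩ := coord_spec V₀ (G.tgt a)
  have htgt : index V₀ (G.eclass a) +ᵥ x = G.tgt a := by
    rw [index_eclass, coord_eq_zero hsrc, sub_zero, hcoord]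
  obtain ⟨p, hp⟩ := (hT_tree.connected.preconnected ⟨G.src a, hT ▸ hsrc⟩
    ⟨x, hT ▸ hx⟩).exists_isPath
  refine ⟨x, fun θ Y => ?_⟩
  rw [htgt]
  refine (norm_sub_sq_le_length_add_one_mul (fun y : T.verts => bloch V₀ θ Y y) p _).trans ?_
  rw [norm_sub_rev, norm_bloch_src_sub_tgt_sq]
  gcongr
  · exact add_nonneg (sq_nonneg _) (List.sum_nonneg (by simp))
  · exact_mod_cast length_add_one_le_nu hT.le hp
  · exact edgeEnergy_add_sum_darts_le hT.le hp.isTrail he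

end Tree

section Bridges

variable (V₀ : G.FundamentalVertexSet) {ω : EuclideanSpace ℝ (Fin d)}

theorem mem_bridges {V₀ : G.FundamentalVertexSet} {O : G.Orientation} {e : G.FundEdge} :
    e ∈ bridges V₀ O ↔ e ∈ O.carrier ∧ index V₀ e ≠ 0 := by
  simp [bridges]

theorem sum_pairing_sq_eq_sum_mulVec_sq {ι : Type*} [Fintype ι] (b : ι → G.FundEdge)
    (ω : EuclideanSpace ℝ (Fin d)) :
    ∑ i, pairing V₀ (b i) ω ^ 2 = ∑ i, (indexMatrix V₀ b).mulVec ω.ofLp i ^ 2 := rfl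

theorem sum_bridges_pairing_sq_eq (O : G.Orientation) (ω : EuclideanSpace ℝ (Fin d)) :
    ∑ e ∈ bridges V₀ O, pairing V₀ e ω ^ 2 =
      ∑ e, (indexMatrix V₀ fun e : bridges V₀ O => (e : G.FundEdge)).mulVec ω.ofLp e ^ 2 :=
  (Finset.sum_coe_sort (bridges V₀ O) fun e => pairing V₀ e ω ^ 2).symm

theorem sum_bridges_pairing_sq_le {O : G.Orientation} {l : ℝ}
    (hl : l ∈ upperBounds (spectrum ℝ
      ((indexMatrix V₀ fun e : bridges V₀ O => (e : G.FundEdge)).transpose *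
        indexMatrix V₀ fun e : bridges V₀ O => (e : G.FundEdge)))) (hω : ‖ω‖ = 1) :
    ∑ e ∈ bridges V₀ O, pairing V₀ e ω ^ 2 ≤ l := by
  rw [sum_bridges_pairing_sq_eq]
  refine (sum_mulVec_sq_le_mul_sum_sq hl _).trans_eq ?_
  rw [← EuclideanSpace.real_norm_sq_eq, hω, one_pow, mul_one]

variable [NeZero d]

theorem exists_posDef_effectiveForm_metricBand_one_zero_eq :
    ∃ M : Matrix (Fin d) (Fin d) ℝ, M.PosDef ∧ ∀ ω : EuclideanSpace ℝ (Fin d),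
      effectiveForm (metricBand V₀ 1 0) 0 ω = ω.ofLp ⬝ᵥ M.mulVec ω.ofLp := by
  obtain ⟨M, hM, hform⟩ :=
    exists_isHermitian_effectiveForm_eq (analyticAt_metricBand_one_zero V₀).contDiffAt
  refine ⟨M, posDef_of_forall_norm_eq_one hM fun ω hω => ?_, hform⟩
  rw [← hform, effectiveForm_metricBand_one_zero V₀ hω]
  exact mul_pos two_pos (effectiveForm_band_one_pos V₀ hω)

theorem effectiveForm_metricBand_one_zero_le (O : G.Orientation) (hω : ‖ω‖ = 1) :
    effectiveForm (metricBand V₀ 1 0) 0 ω ≤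
      2 / (G.totalDeg : ℝ) * ∑ e ∈ bridges V₀ O, pairing V₀ e ω ^ 2 := by
  rw [effectiveForm_metricBand_one_zero V₀ hω, ← mul_one_div, mul_assoc]
  gcongr
  exact effectiveForm_band_one_le V₀ O hω

theorem injective_indexMatrix_bridges_mulVec (O : G.Orientation) :
    Function.Injective (indexMatrix V₀ fun e : bridges V₀ O => (e : G.FundEdge)).mulVec := by
  refine (injective_iff_map_eq_zero (indexMatrix V₀ _).mulVecLin).mpr fun x hx => ?_
  by_contra hx_ne
  let ω : EuclideanSpace ℝ (Fin d) := WithLp.toLp 2 x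
  have hω : ω ≠ 0 := by simpa [ω] using hx_ne
  have hzero : ∑ e ∈ bridges V₀ O, pairing V₀ e (‖ω‖⁻¹ • ω) ^ 2 = 0 := by
    rw [sum_bridges_pairing_sq_eq, WithLp.ofLp_smul, Matrix.mulVec_smul]
    simp [show (indexMatrix V₀ _).mulVec ω.ofLp = 0 from hx]
  have hunit : ‖‖ω‖⁻¹ • ω‖ = 1 := norm_smul_inv_norm (𝕜 := ℝ) hω
  have hle := effectiveForm_band_one_le V₀ O hunit
  rw [hzero, mul_zero] at hle
  exact hle.not_gt (effectiveForm_band_one_pos V₀ hunit)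

theorem exists_linearIndependent_bridges (O : G.Orientation) :
    ∃ b : Fin d → G.FundEdge,
      (∀ i, b i ∈ bridges V₀ O) ∧ LinearIndependent ℝ (indexMatrix V₀ b).row := by
  obtain ⟨b, hb⟩ := exists_linearIndependent_row_comp (injective_indexMatrix_bridges_mulVec V₀ O)
  exact ⟨fun i => b i, fun i => (b i).2, hb⟩

variable {V₀} {ι : Type*} [Fintype ι] {b : ι → G.FundEdge}

theorem sum_pairing_sq_le_effectiveForm_of_isTree (hV₀ : V₀.IsTree)
    (hb : ∀ i, index V₀ (b i) ≠ 0) (hω : ‖ω‖ = 1) :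
    ∑ i, pairing V₀ (b i) ω ^ 2 ≤
      G.nu * Fintype.card ι * (G.totalDeg * effectiveForm (band V₀ 1) 0 ω) := by
  choose x hx using fun i => norm_bloch_index_vadd_sub_sq_le hV₀ (hb i)
  refine sum_latticePairing_sq_le_effectiveForm V₀ (x := x) (by positivity)
    (fun θ Y => ?_) hω
  refine (Finset.sum_le_sum fun i _ => hx i θ Y).trans_eq ?_
  rw [Finset.sum_const, Finset.card_univ, nsmul_eq_mul, mul_left_comm, mul_assoc]

theorem le_effectiveForm_metricBand_of_isTree [Nonempty ι] {l : ℝ} (hV₀ : V₀.IsTree)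
    (hb : ∀ i, index V₀ (b i) ≠ 0)
    (hl : l ∈ lowerBounds (spectrum ℝ ((indexMatrix V₀ b).transpose * indexMatrix V₀ b)))
    (hω : ‖ω‖ = 1) :
    2 * l / (G.totalDeg * G.nu * Fintype.card ι) ≤ effectiveForm (metricBand V₀ 1 0) 0 ω := by
  have hdeg : (0 : ℝ) < G.totalDeg := mod_cast totalDeg_pos
  have hnu : (0 : ℝ) < G.nu := mod_cast nu_pos
  have hle := mul_sum_sq_le_sum_mulVec_sq hl ω.ofLp
  rw [← EuclideanSpace.real_norm_sq_eq, hω, one_pow, mul_one,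
    ← sum_pairing_sq_eq_sum_mulVec_sq] at hle
  have hform := hle.trans (sum_pairing_sq_le_effectiveForm_of_isTree hV₀ hb hω)
  rw [effectiveForm_metricBand_one_zero V₀ hω, div_le_iff₀ (by positivity)]
  linarith

end Bridges

end PeriodicGraph

open PeriodicGraph in
theorem theorem3p1_general {d : ℕ} [NeZero d] {V A : Type*}
    [AddAction (Fin d → ℤ) V] [AddAction (Fin d → ℤ) A]
    (G : PeriodicGraph d V A) (V₀ : G.FundamentalVertexSet) (O : G.Orientation) :
    (∀ (θ : EuclideanSpace ℝ (Fin d)) (E : ℝ), (∀ k : ℤ, k ≠ 0 → E ≠ (Real.pi * k) ^ 2) →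
      Module.Finite ℂ (metricEigenspace V₀ O θ E) ∧
      Module.finrank ℂ (metricEigenspace V₀ O θ E) =
        Nat.card {q : ℕ × ℕ // 1 ≤ q.1 ∧ q.1 ≤ G.nu ∧ metricBand V₀ q.1 q.2 θ = E}) ∧
    (∀ (n j : ℕ) (θ₀ : EuclideanSpace ℝ (Fin d)), 1 ≤ n → n ≤ G.nu - numFlat V₀ →
      IsLocalExtr (metricBand V₀ n j) θ₀ →
      (∀ k : ℤ, metricBand V₀ n j θ₀ ≠ (Real.pi * k) ^ 2) →
      IsSimpleMetricEigenvalue V₀ O θ₀ (metricBand V₀ n j θ₀) →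
      HasEffectiveForm (band V₀ n) θ₀ ∧ HasEffectiveForm (metricBand V₀ n j) θ₀ ∧
      ∀ ω : EuclideanSpace ℝ (Fin d), ‖ω‖ = 1 →
        effectiveForm (metricBand V₀ n j) θ₀ ω =
          2 * Real.sqrt (metricBand V₀ n j θ₀) / Real.sin (Real.sqrt (metricBand V₀ n j θ₀)) *
            effectiveForm (band V₀ n) θ₀ ω) ∧
    (HasEffectiveForm (band V₀ 1) 0 ∧ HasEffectiveForm (metricBand V₀ 1 0) 0 ∧
      (∃ M : Matrix (Fin d) (Fin d) ℝ, M.PosDef ∧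
        ∀ ω : EuclideanSpace ℝ (Fin d), ‖ω‖ = 1 →
          effectiveForm (metricBand V₀ 1 0) 0 ω = ω.ofLp ⬝ᵥ M.mulVec ω.ofLp) ∧
      (∀ ω : EuclideanSpace ℝ (Fin d), ‖ω‖ = 1 →
        effectiveForm (metricBand V₀ 1 0) 0 ω = 2 * effectiveForm (band V₀ 1) 0 ω ∧
        effectiveForm (metricBand V₀ 1 0) 0 ω ≤
          2 / (G.totalDeg : ℝ) * ∑ e ∈ bridges V₀ O, pairing V₀ e ω ^ 2 ∧
        ∀ Λ₁ : ℝ,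
          IsGreatest (spectrum ℝ
            ((indexMatrix V₀ (fun e : bridges V₀ O => (e : G.FundEdge))).transpose *
              indexMatrix V₀ (fun e : bridges V₀ O => (e : G.FundEdge)))) Λ₁ →
          2 / (G.totalDeg : ℝ) * ∑ e ∈ bridges V₀ O, pairing V₀ e ω ^ 2 ≤
            2 * Λ₁ / (G.totalDeg : ℝ)) ∧
      (∃ b : Fin d → G.FundEdge,
        (∀ s, b s ∈ bridges V₀ O) ∧ LinearIndependent ℝ (indexMatrix V₀ b).row) ∧
      (V₀.IsTree → ∀ b : Fin d → G.FundEdge,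
        (∀ s, b s ∈ bridges V₀ O) → LinearIndependent ℝ (indexMatrix V₀ b).row →
        ∀ Λ₀ : ℝ, IsLeast (spectrum ℝ ((indexMatrix V₀ b).transpose * indexMatrix V₀ b)) Λ₀ →
        ∀ ω : EuclideanSpace ℝ (Fin d), ‖ω‖ = 1 →
          0 < 2 * Λ₀ / (G.totalDeg * G.nu * d : ℝ) ∧
          2 * Λ₀ / (G.totalDeg * G.nu * d : ℝ) ≤ effectiveForm (metricBand V₀ 1 0) 0 ω)) := by
  refine ⟨fun θ E hE => ⟨finite_metricEigenspace_of_ne V₀ O θ hE,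
      finrank_metricEigenspace_eq_card V₀ O θ hE⟩,
    fun n j θ₀ hn hn_le hext hk hs => effectiveForm_metricBand (by lia) hext hk hs,
    hasEffectiveForm_band_one V₀, hasEffectiveForm_metricBand_one_zero V₀, ?_,
    fun ω hω => ⟨effectiveForm_metricBand_one_zero V₀ hω,
      effectiveForm_metricBand_one_zero_le V₀ O hω, fun Λ₁ hΛ₁ => ?_⟩,
    exists_linearIndependent_bridges V₀ O, fun hV₀ b hb hb_indep Λ₀ hΛ₀ ω hω => ⟨?_, ?_⟩⟩
  · obtain ⟨M, hM, hform⟩ := exists_posDef_effectiveForm_metricBand_one_zero_eq V₀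
    exact ⟨M, hM, fun ω _ => hform ω⟩
  · rw [div_mul_eq_mul_div]
    gcongr
    exact sum_bridges_pairing_sq_le V₀ hΛ₁.2 hω
  · have hinj : Function.Injective (indexMatrix V₀ b).mulVec :=
      Matrix.mulVec_injective_iff_isUnit.mpr (Matrix.linearIndependent_rows_iff_isUnit.mp hb_indep)
    have hΛ₀_pos : 0 < Λ₀ := pos_of_mem_spectrum_transpose_mul_self hinj hΛ₀.1
    have hdeg : (0 : ℝ) < G.totalDeg := mod_cast totalDeg_pos
    have hnu : (0 : ℝ) < G.nu := mod_cast nu_pos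
    have hd : (0 : ℝ) < d := mod_cast NeZero.pos d
    positivity
  · simpa only [Fintype.card_fin] using
      le_effectiveForm_metricBand_of_isTree hV₀ (fun i => (mem_bridges.mp (hb i)).2) hΛ₀.2 hω

open PeriodicGraph in
theorem theorem3p1 {d : ℕ} (hd : 2 ≤ d) {V A : Type*}
    [AddAction (Fin d → ℤ) V] [AddAction (Fin d → ℤ) A]
    (G : PeriodicGraph d V A) (V₀ : G.FundamentalVertexSet) (O : G.Orientation) :
    -- outside `{(πk)² : k ≠ 0}`, the `E_{n,j}(θ)` are the eigenvalues of `Δ_M(θ)` with multiplicity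
    (∀ (θ : EuclideanSpace ℝ (Fin d)) (E : ℝ), (∀ k : ℤ, k ≠ 0 → E ≠ (Real.pi * k) ^ 2) →
      Module.Finite ℂ (metricEigenspace V₀ O θ E) ∧
      Module.finrank ℂ (metricEigenspace V₀ O θ E) =
        Nat.card {q : ℕ × ℕ // 1 ≤ q.1 ∧ q.1 ≤ G.nu ∧ metricBand V₀ q.1 q.2 θ = E}) ∧
    -- part i)
    (∀ (n j : ℕ) (θ₀ : EuclideanSpace ℝ (Fin d)), 1 ≤ n → n ≤ G.nu - numFlat V₀ →
      IsLocalExtr (metricBand V₀ n j) θ₀ →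
      (∀ k : ℤ, metricBand V₀ n j θ₀ ≠ (Real.pi * k) ^ 2) →
      IsSimpleMetricEigenvalue V₀ O θ₀ (metricBand V₀ n j θ₀) →
      HasEffectiveForm (band V₀ n) θ₀ ∧ HasEffectiveForm (metricBand V₀ n j) θ₀ ∧
      ∀ ω : EuclideanSpace ℝ (Fin d), ‖ω‖ = 1 →
        effectiveForm (metricBand V₀ n j) θ₀ ω =
          2 * Real.sqrt (metricBand V₀ n j θ₀) / Real.sin (Real.sqrt (metricBand V₀ n j θ₀)) *
            effectiveForm (band V₀ n) θ₀ ω) ∧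
    -- part ii)
    (HasEffectiveForm (band V₀ 1) 0 ∧ HasEffectiveForm (metricBand V₀ 1 0) 0 ∧
      -- non-degeneracy
      (∃ M : Matrix (Fin d) (Fin d) ℝ, M.PosDef ∧
        ∀ ω : EuclideanSpace ℝ (Fin d), ‖ω‖ = 1 →
          effectiveForm (metricBand V₀ 1 0) 0 ω = ω.ofLp ⬝ᵥ M.mulVec ω.ofLp) ∧
      -- identity and upper bounds
      (∀ ω : EuclideanSpace ℝ (Fin d), ‖ω‖ = 1 →
        effectiveForm (metricBand V₀ 1 0) 0 ω = 2 * effectiveForm (band V₀ 1) 0 ω ∧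
        effectiveForm (metricBand V₀ 1 0) 0 ω ≤
          2 / (G.totalDeg : ℝ) * ∑ e ∈ bridges V₀ O, pairing V₀ e ω ^ 2 ∧
        ∀ Λ₁ : ℝ,
          IsGreatest (spectrum ℝ ((indexMatrix V₀ (fun e : bridges V₀ O => (e : G.FundEdge))).transpose *
            indexMatrix V₀ (fun e : bridges V₀ O => (e : G.FundEdge)))) Λ₁ →
          2 / (G.totalDeg : ℝ) * ∑ e ∈ bridges V₀ O, pairing V₀ e ω ^ 2 ≤
            2 * Λ₁ / (G.totalDeg : ℝ)) ∧
      -- existence of `d` bridges with linearly independent indices, and the lower bound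
      (∃ b : Fin d → G.FundEdge,
        (∀ s, b s ∈ bridges V₀ O) ∧ LinearIndependent ℝ (indexMatrix V₀ b).row) ∧
      (V₀.IsTree → ∀ b : Fin d → G.FundEdge,
        (∀ s, b s ∈ bridges V₀ O) → LinearIndependent ℝ (indexMatrix V₀ b).row →
        ∀ Λ₀ : ℝ, IsLeast (spectrum ℝ ((indexMatrix V₀ b).transpose * indexMatrix V₀ b)) Λ₀ →
        ∀ ω : EuclideanSpace ℝ (Fin d), ‖ω‖ = 1 →
          0 < 2 * Λ₀ / (G.totalDeg * G.nu * d : ℝ) ∧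
          2 * Λ₀ / (G.totalDeg * G.nu * d : ℝ) ≤ effectiveForm (metricBand V₀ 1 0) 0 ω)) := by
  have : NeZero d := ⟨by lia⟩
  exact theorem3p1_general G V₀ O
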